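/- All graphs are finite and undirected; multiple edges are allowed, loops are not. A proper $t$-edge coloring of a graph $G$ is a map $\alpha\colon E(G)\to\{1,\dots,t\}$ such that distinct edges sharing an endpoint receive distinct values; the chromatic index $\chi'(G)$ is the least $t$ for which one exists, and $\Delta(G)$ is the maximum degree of $G$. The graph $G$ is interval colorable if, for some $t$, it has a proper $t$-edge coloring such that at every vertex the colors of the incident edges form a (possibly empty) interval of integers. Theorem. Let $G$ be a graph with $\chi'(G)=\Delta(G)\le 3$. If no component of $G$ is an odd cycle, then $G$ is interval colorable. -/

import Mathlib

/-!
Finite multigraphs are modelled by Mathlib's `Graph α β` (vertices in `α`, edges in `β`, parallel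
edges allowed). The notions of edge colouring needed for them are defined here.
-/

namespace Graph

variable {α β : Type*}

/-- The degree of the vertex `v`: the number of edges at `v`, loops being counted twice. -/
noncomputable def degree (G : Graph α β) (v : α) : ℕ :=
  (G.incidenceSet v).ncard + (G.loopSet v).ncard

/-- The maximum degree `Δ(G)` of a finite multigraph (`0` if there are no vertices). -/
noncomputable def maxDegree (G : Graph α β) : ℕ :=
  sSup (G.degree '' G.vertexSet)

/-- `c` is a proper `t`-edge colouring of `G`: it maps the edges to `{1, …, t}`, and distinct edges
with a common endpoint (in particular parallel edges) get distinct colours. The values of `c` outside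
the edge set are irrelevant. -/
def IsProperEdgeColoring (G : Graph α β) (t : ℕ) (c : β → ℕ) : Prop :=
  (∀ e ∈ G.edgeSet, c e ∈ Set.Icc 1 t) ∧
    ∀ e f x, G.Inc e x → G.Inc f x → e ≠ f → c e ≠ c f

/-- The chromatic index `χ'(G)`: the minimum `t` for which there is a proper `t`-edge colouring. -/
noncomputable def chromaticIndex (G : Graph α β) : ℕ :=
  sInf {t : ℕ | ∃ c : β → ℕ, G.IsProperEdgeColoring t c}

/-- For a finite multigraph the minimum that defines the chromatic index is attained. -/
theorem exists_isProperEdgeColoring_chromaticIndex (G : Graph α β) (hE : G.edgeSet.Finite) :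
    ∃ c : β → ℕ, G.IsProperEdgeColoring G.chromaticIndex c := by
  apply Nat.sInf_mem (s := {t : ℕ | ∃ c : β → ℕ, G.IsProperEdgeColoring t c})
  obtain ⟨f, hf⟩ := Set.countable_iff_exists_injOn.1 hE.countable
  obtain ⟨t, ht⟩ := (hE.image f).bddAbove
  refine ⟨t + 1, fun e => f e + 1, fun e he => ?_, ?_⟩
  · have := ht (Set.mem_image_of_mem f he)
    exact ⟨Nat.le_add_left 1 (f e), Nat.succ_le_succ this⟩
  · intro e e' x he he' hne h
    exact hne (hf he.edge_mem he'.edge_mem (by simpa using h))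

/-- `c` is an interval `t`-colouring of `G`: a proper `t`-edge colouring such that the colours at
each vertex form an interval of integers (the empty interval at an isolated vertex). -/
def IsIntervalColoring (G : Graph α β) (t : ℕ) (c : β → ℕ) : Prop :=
  G.IsProperEdgeColoring t c ∧
    ∀ v ∈ G.vertexSet, ∃ a b : ℕ, c '' G.incidenceSet v = Set.Icc a b

/-- `G` is interval colourable if it has an interval `t`-colouring for some `t`. -/
def IntervalColorable (G : Graph α β) : Prop :=
  ∃ (t : ℕ) (c : β → ℕ), G.IsIntervalColoring t c

/-- `G` is connected: it has a vertex, and any two vertices are joined by a walk. -/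
def Connected (G : Graph α β) : Prop :=
  G.vertexSet.Nonempty ∧
    ∀ x ∈ G.vertexSet, ∀ y ∈ G.vertexSet, Relation.ReflTransGen G.Adj x y

/-- `H` is a component of `G`: a maximal connected subgraph. -/
def IsComponent (H G : Graph α β) : Prop :=
  Maximal (fun K : Graph α β => K ≤ G ∧ K.Connected) H

/-- `G` is a cycle of length `n ≥ 1`: its distinct vertices `v 0, …, v (n - 1)` and its distinct
edges `e 0, …, e (n - 1)` are arranged cyclically, `e i` joining `v i` to `v (i + 1)`. -/
def IsCycleOfLength (G : Graph α β) (n : ℕ) : Prop :=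
  1 ≤ n ∧ ∃ (v : ZMod n → α) (e : ZMod n → β),
    Function.Injective v ∧ Function.Injective e ∧
      Set.range v = G.vertexSet ∧ Set.range e = G.edgeSet ∧
      ∀ i, G.IsLink (e i) (v i) (v (i + 1))

/-- `G` is a cycle of odd length. -/
def IsOddCycle (G : Graph α β) : Prop :=
  ∃ n : ℕ, Odd n ∧ G.IsCycleOfLength n

end Graph

/-! Call a vertex cubic if it has at least three incident edges. Take a proper 3-edge-colouring with
as few edges of colour 3 as possible, and an edge e = uv of colour 3 with no cubic end. The ends
miss different colours among 1 and 2, and the Kempe chain in these colours from u must end at v: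
otherwise flipping it would let e be recoloured (`IsMinThreeColoring.mem_chain`). If the chain has
no cubic vertex, then chain and e form a component that is an odd cycle
(`IsMinThreeColoring.exists_isOddCycle`). So cubic vertices can be reached. Minimise also the sum of
the distances to them over the ends of edges of colour 3; then an edge h joins an end of e to a
cubic vertex, since otherwise colour 3 could slide along the chain from e to an edge nearer the
cubic vertices. Let P contain one such repairing edge for each e.

The interval colouring sends 1 to 3, 2 to 4 and 3 to 2 or 5, except that edges of P go from 1 to 6
and from 2 to 1. Values stay in separate classes modulo 3, so the result is proper. A vertex whose
edges outside P show exactly one of the colours 1, 2 dictates the choice between 2 and 5 on its edge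
of colour 3. When the two ends of an edge disagree, one of them is a cubic end of some h in P.
Flipping the chain of h settles the dispute and starts no new one, because this chain meets no other
edge of P (`IsRepairSet.exists_flip_of_conflict`). -/

namespace Graph

/-! ### Orbits of two involutions -/

section Dihedral

variable {α : Type*} {s t : Equiv.Perm α} {u : α}

/-- Conjugation by t inverts the rotation t * s, and t fixes u. Hence powers of the rotation alone
already sweep out the orbit of u under both involutions. -/
lemma apply_zpow_of_fixed (hs : s * s = 1) (ht : t * t = 1) (hu : t u = u) (k : ℤ) :
    t (((t * s) ^ k) u) = ((t * s) ^ (-k)) u := by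
  have hs' : s⁻¹ = s := inv_eq_of_mul_eq_one_left hs
  have ht' : t⁻¹ = t := inv_eq_of_mul_eq_one_left ht
  have h : t * (t * s) * t⁻¹ = (t * s)⁻¹ := by
    rw [mul_inv_rev, hs', ht', ← mul_assoc, ht, one_mul]
  have h2 : t * (t * s) ^ k * t⁻¹ = (t * s) ^ (-k) := by
    rw [← conj_zpow, h, inv_zpow, zpow_neg]
  rw [← h2, ht']
  simp [Equiv.Perm.mul_apply, hu]

lemma apply_zpow_of_fixed' (hs : s * s = 1) (ht : t * t = 1) (hu : t u = u) (k : ℤ) :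
    s (((t * s) ^ k) u) = ((t * s) ^ (-k - 1)) u := by
  have h := apply_zpow_of_fixed hs ht hu (k + 1)
  rw [add_comm k 1, zpow_add, zpow_one, Equiv.Perm.mul_apply, Equiv.Perm.mul_apply,
    ← Equiv.Perm.mul_apply t t, ht, Equiv.Perm.one_apply] at h
  rw [h, show -(1 + k) = -k - 1 by ring]

lemma zpow_apply_eq_iff {r : Equiv.Perm α} (a b : ℤ) :
    (r ^ a) u = (r ^ b) u ↔ (Function.minimalPeriod r u : ℤ) ∣ a - b := by
  have h := MulAction.zpow_smul_eq_iff_minimalPeriod_dvd (a := r) (b := u) (n := a - b)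
  have h' : (Function.minimalPeriod (r • ·) u) = Function.minimalPeriod r u := rfl
  rw [h'] at h
  rw [← h, Equiv.Perm.smul_def, sub_eq_neg_add, zpow_add, Equiv.Perm.mul_apply, zpow_neg,
    Equiv.Perm.inv_eq_iff_eq]

lemma minimalPeriod_dvd_of_fixed' (hs : s * s = 1) (ht : t * t = 1) (hu : t u = u) {k : ℤ}
    (hv : s (((t * s) ^ k) u) = ((t * s) ^ k) u) :
    (Function.minimalPeriod (t * s) u : ℤ) ∣ 2 * k + 1 := by
  rw [apply_zpow_of_fixed' hs ht hu, zpow_apply_eq_iff] at hv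
  rw [show 2 * k + 1 = -(-k - 1 - k) by ring]
  exact dvd_neg.2 hv

/-- A path has only two ends: a fixed point of t at exponent j makes the period divide 2j, and it
also divides the odd number 2k + 1, so it divides j. -/
lemma eq_of_fixed (hs : s * s = 1) (ht : t * t = 1) (hu : t u = u) {k j : ℤ}
    (hv : s (((t * s) ^ k) u) = ((t * s) ^ k) u)
    (hy : t (((t * s) ^ j) u) = ((t * s) ^ j) u) : ((t * s) ^ j) u = u := by
  have h1 := minimalPeriod_dvd_of_fixed' hs ht hu hv
  rw [apply_zpow_of_fixed hs ht hu, zpow_apply_eq_iff] at hy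
  have h : ((t * s) ^ j) u = ((t * s) ^ (0 : ℤ)) u := by
    rw [zpow_apply_eq_iff]
    rw [show j - 0 = j * (2 * k + 1) + k * (-j - j) by ring]
    exact dvd_add (h1.mul_left j) (hy.mul_left k)
  simpa using h

lemma eq_of_fixed' (hs : s * s = 1) (ht : t * t = 1) (hu : t u = u) {k j : ℤ}
    (hv : s (((t * s) ^ k) u) = ((t * s) ^ k) u)
    (hy : s (((t * s) ^ j) u) = ((t * s) ^ j) u) : ((t * s) ^ j) u = ((t * s) ^ k) u := by
  have h1 := minimalPeriod_dvd_of_fixed' hs ht hu hv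
  have h2 := minimalPeriod_dvd_of_fixed' hs ht hu hy
  rw [zpow_apply_eq_iff]
  rw [show j - k = j * (2 * k + 1) - k * (2 * j + 1) by ring]
  exact dvd_sub (h1.mul_left j) (h2.mul_left k)

end Dihedral

/-! ### Kempe chains and flips -/

section Coloring

variable {α β : Type*} {G : Graph α β} {c : β → ℕ} {e f : β} {i j : ℕ} {x y u v : α}

lemma IsLink.ne_of_loopless (hl : G.Loopless) (h : G.IsLink e x y) : x ≠ y := by
  rintro rfl
  exact hl.not_isLoopAt e x h

/-- No edge at `x` has colour `i`. -/
def Missing (G : Graph α β) (c : β → ℕ) (i : ℕ) (x : α) : Prop :=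
  ∀ e, G.Inc e x → c e ≠ i

/-- The vertices with (at least) three incident edges. -/
def cubicSet (G : Graph α β) : Set α := {x | 3 ≤ (G.incidenceSet x).ncard}

lemma IsProperEdgeColoring.eq_of_inc {t : ℕ} (hc : G.IsProperEdgeColoring t c) (he : G.Inc e x)
    (hf : G.Inc f x) (h : c e = c f) : e = f :=
  by_contra fun hne => hc.2 e f x he hf hne h

lemma IsProperEdgeColoring.color_cases (hc : G.IsProperEdgeColoring 3 c) (he : G.Inc e x) :
    c e = 1 ∨ c e = 2 ∨ c e = 3 := by
  have := hc.1 e he.edge_mem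
  rw [Set.mem_Icc] at this
  omega

lemma IsProperEdgeColoring.mem_cubicSet_iff (hc : G.IsProperEdgeColoring 3 c) :
    x ∈ G.cubicSet ↔ ¬ G.Missing c 1 x ∧ ¬ G.Missing c 2 x ∧ ¬ G.Missing c 3 x := by
  have hinj : Set.InjOn c (G.incidenceSet x) := fun a ha b hb h => hc.eq_of_inc ha hb h
  have hsub : c '' G.incidenceSet x ⊆ {1, 2, 3} := by
    rintro _ ⟨a, ha, rfl⟩
    exact hc.color_cases ha
  have hn : ({1, 2, 3} : Set ℕ).ncard = 3 := by
    rw [Set.ncard_eq_toFinset_card']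
    rfl
  have hmiss : ∀ i, ¬ G.Missing c i x ↔ i ∈ c '' G.incidenceSet x := by
    intro i
    simp [Missing, and_comm]
  simp only [cubicSet, Set.mem_ofPred_eq, hmiss]
  rw [← hinj.ncard_image]
  constructor
  · intro h
    have := Set.eq_of_subset_of_ncard_le hsub (by omega) (by simp)
    simp [this]
  · rintro ⟨h1, h2, h3⟩
    rw [← hn]
    refine Set.ncard_le_ncard ?_ (Set.Finite.subset (by simp) hsub)
    rintro i (rfl | rfl | rfl) <;> assumption

/-- The neighbour of `x` along its edge of colour `i`, or `x` itself if there is none. -/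
noncomputable def nbr (G : Graph α β) (c : β → ℕ) (i : ℕ) (x : α) : α :=
  open Classical in if h : ∃ y e, G.IsLink e x y ∧ c e = i then h.choose else x

lemma IsProperEdgeColoring.nbr_eq {t : ℕ} (hc : G.IsProperEdgeColoring t c)
    (h : G.IsLink e x y) (hi : c e = i) : G.nbr c i x = y := by
  have hex : ∃ y e, G.IsLink e x y ∧ c e = i := ⟨y, e, h, hi⟩
  rw [nbr, dif_pos hex]
  obtain ⟨f, hf, hfi⟩ := hex.choose_spec
  obtain rfl := hc.eq_of_inc h.inc_left hf.inc_left (hi.trans hfi.symm)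
  exact hf.right_unique h

lemma nbr_of_missing (h : G.Missing c i x) : G.nbr c i x = x := by
  rw [nbr, dif_neg]
  rintro ⟨y, e, he, hi⟩
  exact h e he.inc_left hi

lemma exists_isLink_nbr (h : ¬ G.Missing c i x) : ∃ e, G.IsLink e x (G.nbr c i x) ∧ c e = i := by
  have hex : ∃ y e, G.IsLink e x y ∧ c e = i := by
    simp only [Missing, not_forall, not_not] at h
    obtain ⟨e, ⟨y, hy⟩, hi⟩ := h
    exact ⟨y, e, hy, hi⟩
  rw [nbr, dif_pos hex]
  exact hex.choose_spec

lemma IsProperEdgeColoring.nbr_involutive {t : ℕ} (hc : G.IsProperEdgeColoring t c) (i : ℕ) :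
    Function.Involutive (G.nbr c i) := by
  intro x
  by_cases h : G.Missing c i x
  · rw [nbr_of_missing h, nbr_of_missing h]
  · obtain ⟨e, he, hi⟩ := exists_isLink_nbr h
    exact hc.nbr_eq he.symm hi

/-- `nbr` as a permutation. -/
noncomputable def nbrPerm {t : ℕ} (hc : G.IsProperEdgeColoring t c) (i : ℕ) : Equiv.Perm α :=
  (hc.nbr_involutive i).toPerm

lemma nbrPerm_apply {t : ℕ} (hc : G.IsProperEdgeColoring t c) (i : ℕ) (x : α) :
    nbrPerm hc i x = G.nbr c i x := rfl

lemma nbrPerm_mul_self {t : ℕ} (hc : G.IsProperEdgeColoring t c) (i : ℕ) :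
    nbrPerm hc i * nbrPerm hc i = 1 := by
  ext x
  exact hc.nbr_involutive i x

/-- The Kempe chain of `u` for the colours `i` and `j`, when `j` is missing at `u`. -/
def chain {t : ℕ} (hc : G.IsProperEdgeColoring t c) (i j : ℕ) (u : α) : Set α :=
  Set.range fun k : ℤ => ((nbrPerm hc j * nbrPerm hc i) ^ k) u

lemma self_mem_chain {t : ℕ} (hc : G.IsProperEdgeColoring t c) : u ∈ chain hc i j u :=
  ⟨0, by simp⟩

/-- `S` is closed under the edges of the colours other than `3`. -/
def KempeClosed (G : Graph α β) (c : β → ℕ) (S : Set α) : Prop :=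
  ∀ e x y, G.IsLink e x y → c e ≠ 3 → x ∈ S → y ∈ S

lemma kempeClosed_chain (hc : G.IsProperEdgeColoring 3 c) (hij : (i = 1 ∧ j = 2) ∨ (i = 2 ∧ j = 1))
    (hu : G.Missing c j u) : G.KempeClosed c (chain hc i j u) := by
  rintro e _ y he h3 ⟨k, rfl⟩
  have hu' : nbrPerm hc j u = u := nbr_of_missing hu
  have hcol := hc.color_cases he.inc_left
  have : c e = i ∨ c e = j := by omega
  rcases this with h | h
  · rw [← hc.nbr_eq he h, ← nbrPerm_apply hc]
    exact ⟨-k - 1,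
      (apply_zpow_of_fixed' (nbrPerm_mul_self hc i) (nbrPerm_mul_self hc j) hu' k).symm⟩
  · rw [← hc.nbr_eq he h, ← nbrPerm_apply hc]
    exact ⟨-k,
      (apply_zpow_of_fixed (nbrPerm_mul_self hc i) (nbrPerm_mul_self hc j) hu' k).symm⟩

/-- A missing colour is a fixed point of the corresponding involution, so the dihedral lemmas leave
only the two ends u and v. -/
lemma eq_of_mem_chain (hc : G.IsProperEdgeColoring 3 c) (hu : G.Missing c j u)
    (hv : G.Missing c i v) (hvS : v ∈ chain hc i j u) (hy : y ∈ chain hc i j u)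
    (hmiss : G.Missing c i y ∨ G.Missing c j y) : y = u ∨ y = v := by
  obtain ⟨k, rfl⟩ := hvS
  obtain ⟨l, rfl⟩ := hy
  have hu' : nbrPerm hc j u = u := nbr_of_missing hu
  rcases hmiss with h | h
  · exact .inr (eq_of_fixed' (nbrPerm_mul_self hc i) (nbrPerm_mul_self hc j) hu'
      (nbr_of_missing hv) (nbr_of_missing h))
  · exact .inl (eq_of_fixed (nbrPerm_mul_self hc i) (nbrPerm_mul_self hc j) hu'
      (nbr_of_missing hv) (nbr_of_missing h))

/-- Interchange the colours `1` and `2` on the edges that meet `S`. -/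
noncomputable def flip (G : Graph α β) (c : β → ℕ) (S : Set α) (e : β) : ℕ :=
  open Classical in if c e ≠ 3 ∧ ∃ x ∈ S, G.Inc e x then 3 - c e else c e

variable {S : Set α}

lemma flip_of_eq_three (h : c e = 3) : G.flip c S e = c e := by
  simp [flip, h]

lemma flip_of_mem (he : G.Inc e x) (hx : x ∈ S) (h : c e ≠ 3) : G.flip c S e = 3 - c e := by
  rw [flip, if_pos ⟨h, x, hx, he⟩]

lemma KempeClosed.flip_of_notMem (hS : G.KempeClosed c S) (he : G.Inc e x) (hx : x ∉ S) :
    G.flip c S e = c e := by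
  rw [flip, if_neg]
  rintro ⟨h3, y, hy, hey⟩
  obtain ⟨z, hz⟩ := he
  rcases hey.eq_or_eq_of_isLink hz with rfl | rfl
  · exact hx hy
  · exact hx (hS e _ _ hz.symm h3 hy)

lemma KempeClosed.isProperEdgeColoring_flip (hS : G.KempeClosed c S)
    (hc : G.IsProperEdgeColoring 3 c) : G.IsProperEdgeColoring 3 (G.flip c S) := by
  constructor
  · intro e he
    have := hc.1 e he
    rw [Set.mem_Icc] at this ⊢
    unfold flip
    split_ifs <;> omega
  · intro e f x he hf hne h
    have hcne := hc.2 e f x he hf hne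
    have he3 := hc.color_cases he
    have hf3 := hc.color_cases hf
    by_cases hx : x ∈ S
    · by_cases h1 : c e = 3 <;> by_cases h2 : c f = 3
      · omega
      · rw [flip_of_eq_three h1, flip_of_mem hf hx h2] at h
        omega
      · rw [flip_of_eq_three h2, flip_of_mem he hx h1] at h
        omega
      · rw [flip_of_mem he hx h1, flip_of_mem hf hx h2] at h
        omega
    · rw [hS.flip_of_notMem he hx, hS.flip_of_notMem hf hx] at h
      exact hcne h

lemma IsProperEdgeColoring.flip_eq_three_iff (hc : G.IsProperEdgeColoring 3 c)
    (he : e ∈ G.edgeSet) : G.flip c S e = 3 ↔ c e = 3 := by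
  have := hc.1 e he
  rw [Set.mem_Icc] at this
  unfold flip
  split_ifs <;> omega

lemma IsProperEdgeColoring.missing_flip_of_mem (hc : G.IsProperEdgeColoring 3 c) (hx : x ∈ S)
    (hij : (i = 1 ∧ j = 2) ∨ (i = 2 ∧ j = 1)) (h : G.Missing c i x) :
    G.Missing (G.flip c S) j x := by
  intro e he hej
  have := h e he
  have := hc.color_cases he
  by_cases h3 : c e = 3
  · rw [flip_of_eq_three h3] at hej
    omega
  · rw [flip_of_mem he hx h3] at hej
    omega

lemma KempeClosed.missing_flip_of_notMem (hS : G.KempeClosed c S) (hx : x ∉ S)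
    (h : G.Missing c i x) : G.Missing (G.flip c S) i x := by
  intro e he hei
  rw [hS.flip_of_notMem he hx] at hei
  exact h e he hei

end Coloring

/-! ### Colourings with fewest edges of colour 3 -/

section Minimal

variable {α β : Type*} {G : Graph α β} {c : β → ℕ} {e f h : β} {i j : ℕ} {x y u v w : α}

/-- `c` is a proper `3`-edge-colouring with as few edges of colour `3` as possible. -/
def IsMinThreeColoring (G : Graph α β) (c : β → ℕ) : Prop :=
  G.IsProperEdgeColoring 3 c ∧ ∀ c', G.IsProperEdgeColoring 3 c' →
    {e ∈ G.edgeSet | c e = 3}.ncard ≤ {e ∈ G.edgeSet | c' e = 3}.ncard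

lemma IsMinThreeColoring.congr {c' : β → ℕ} (hm : G.IsMinThreeColoring c)
    (hc' : G.IsProperEdgeColoring 3 c') (h : ∀ e ∈ G.edgeSet, (c' e = 3 ↔ c e = 3)) :
    G.IsMinThreeColoring c' := by
  have hset : {e ∈ G.edgeSet | c' e = 3} = {e ∈ G.edgeSet | c e = 3} := by
    ext e
    exact and_congr_right (h e)
  refine ⟨hc', fun c'' hc'' => ?_⟩
  rw [hset]
  exact hm.2 c'' hc''

lemma IsMinThreeColoring.flip {S : Set α} (hm : G.IsMinThreeColoring c)
    (hS : G.KempeClosed c S) : G.IsMinThreeColoring (G.flip c S) :=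
  hm.congr (hS.isProperEdgeColoring_flip hm.1) fun _ he => hm.1.flip_eq_three_iff he

lemma IsProperEdgeColoring.update [DecidableEq β] {t : ℕ} (hc : G.IsProperEdgeColoring t c)
    (he : G.IsLink e u v) (hi : i ∈ Set.Icc 1 t) (hu : G.Missing c i u) (hv : G.Missing c i v) :
    G.IsProperEdgeColoring t (Function.update c e i) := by
  have key : ∀ f x, G.Inc e x → G.Inc f x → f ≠ e → c f ≠ i := by
    intro f x hex hfx _
    rcases hex.eq_or_eq_of_isLink he with rfl | rfl
    · exact hu f hfx
    · exact hv f hfx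
  constructor
  · intro f hf
    rcases eq_or_ne f e with rfl | hne
    · simpa using hi
    · simpa [hne] using hc.1 f hf
  · intro f g x hf hg hne
    rcases eq_or_ne f e with rfl | hfe
    · simpa [hne.symm] using (key g x hf hg hne.symm).symm
    · rcases eq_or_ne g e with rfl | hge
      · simpa [hne] using key f x hg hf hne
      · simpa [hfe, hge] using hc.2 f g x hf hg hne

/-- Otherwise e could be recoloured with i, leaving fewer edges of colour 3. -/
lemma IsMinThreeColoring.not_missing (hE : G.edgeSet.Finite) (hm : G.IsMinThreeColoring c)
    (he : G.IsLink e u v) (h3 : c e = 3) (hi : i = 1 ∨ i = 2) (hu : G.Missing c i u) :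
    ¬ G.Missing c i v := by
  classical
  intro hv
  have hlt : {f ∈ G.edgeSet | Function.update c e i f = 3}.ncard <
      {f ∈ G.edgeSet | c f = 3}.ncard := by
    refine Set.ncard_lt_ncard ⟨?_, fun hsub => ?_⟩ (hE.subset fun _ hf => hf.1)
    · rintro f ⟨hf, hf3⟩
      refine ⟨hf, ?_⟩
      rcases eq_or_ne f e with rfl | hne
      · exact h3
      · simpa [hne] using hf3
    · have := (hsub ⟨he.edge_mem, h3⟩).2
      simp only [Function.update_self] at this
      omega
  have := hm.2 _ (hm.1.update he (i := i) (by rw [Set.mem_Icc]; omega) hu hv)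
  omega

/-- If the chain of u avoided v, flipping it would make both ends of e miss i, against minimality.
-/
lemma IsMinThreeColoring.mem_chain (hE : G.edgeSet.Finite) (hm : G.IsMinThreeColoring c)
    (hij : (i = 1 ∧ j = 2) ∨ (i = 2 ∧ j = 1)) (he : G.IsLink e u v) (h3 : c e = 3)
    (hu : G.Missing c j u) (hv : G.Missing c i v) : v ∈ chain hm.1 i j u := by
  by_contra hvS
  have hS := kempeClosed_chain hm.1 hij hu
  refine (hm.flip hS).not_missing hE he (i := i) ?_ (by omega) ?_
    (hS.missing_flip_of_notMem hvS hv)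
  · rwa [hm.1.flip_eq_three_iff he.edge_mem]
  · exact hm.1.missing_flip_of_mem (self_mem_chain hm.1) (by omega) hu

lemma IsProperEdgeColoring.exists_missing (hc : G.IsProperEdgeColoring 3 c)
    (hx : x ∉ G.cubicSet) (he : G.Inc e x) (h3 : c e = 3) :
    G.Missing c 1 x ∨ G.Missing c 2 x := by
  rw [hc.mem_cubicSet_iff] at hx
  have : ¬ G.Missing c 3 x := fun h => h e he h3
  tauto

/-- The ends of an edge of colour `3` outside the cubic vertices miss different colours. -/
lemma IsMinThreeColoring.exists_colors (hE : G.edgeSet.Finite) (hm : G.IsMinThreeColoring c)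
    (he : G.IsLink e u v) (h3 : c e = 3) (hu : u ∉ G.cubicSet) (hv : v ∉ G.cubicSet) :
    ∃ i j, ((i = 1 ∧ j = 2) ∨ (i = 2 ∧ j = 1)) ∧ G.Missing c j u ∧ G.Missing c i v ∧
      ¬ G.Missing c i u ∧ ¬ G.Missing c j v := by
  have h1 := hm.not_missing hE he h3 (i := 1) (.inl rfl)
  have h2 := hm.not_missing hE he h3 (i := 2) (.inr rfl)
  have hu' := hm.1.exists_missing hu he.inc_left h3
  have hv' := hm.1.exists_missing hv he.inc_right h3
  by_cases hu1 : G.Missing c 1 u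
  · exact ⟨2, 1, .inr ⟨rfl, rfl⟩, by tauto⟩
  · exact ⟨1, 2, .inl ⟨rfl, rfl⟩, by tauto⟩

/-- The Kempe chain through an edge of colour `3` that joins two non-cubic vertices. -/
lemma IsMinThreeColoring.exists_kempeClosed (hE : G.edgeSet.Finite) (hm : G.IsMinThreeColoring c)
    (he : G.IsLink e u v) (h3 : c e = 3) (hu : u ∉ G.cubicSet) (hv : v ∉ G.cubicSet) :
    ∃ S, G.KempeClosed c S ∧ u ∈ S ∧ v ∈ S ∧
      ∀ y ∈ S, G.Missing c 1 y ∨ G.Missing c 2 y → y = u ∨ y = v := by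
  obtain ⟨i, j, hij, hju, hiv, -⟩ := hm.exists_colors hE he h3 hu hv
  have hvS := hm.mem_chain hE hij he h3 hju hiv
  refine ⟨_, kempeClosed_chain hm.1 hij hju, self_mem_chain hm.1, hvS, fun y hy hmiss =>
    eq_of_mem_chain hm.1 hju hiv hvS hy ?_⟩
  rcases hij with ⟨rfl, rfl⟩ | ⟨rfl, rfl⟩
  · exact hmiss
  · exact hmiss.symm

end Minimal

/-! ### Sliding colour 3 along a chain -/

section Slide

variable {α β : Type*} {G : Graph α β} {c : β → ℕ} {e f h : β} {i j : ℕ} {x y u v w : α}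

/-- The vertex w lies on the chain and is neither of its ends, so it has both colours 1 and 2; not
being cubic, it has no room for colour 3. -/
lemma IsMinThreeColoring.missing_three (hE : G.edgeSet.Finite) (hl : G.Loopless)
    (hm : G.IsMinThreeColoring c) (hij : (i = 1 ∧ j = 2) ∨ (i = 2 ∧ j = 1))
    (he : G.IsLink e u v) (h3 : c e = 3) (hu : G.Missing c j u) (hv : G.Missing c i v)
    (hh : G.IsLink h u w) (hi : c h = i) (hw : w ∉ G.cubicSet) : G.Missing c 3 w := by
  by_contra hw3
  have hwi : ¬ G.Missing c i w := fun hm => hm h hh.inc_right hi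
  have hwj : ¬ G.Missing c j w := by
    intro hwj
    have hvS := hm.mem_chain hE hij he h3 hu hv
    have hwS := kempeClosed_chain hm.1 hij hu h u w hh (by omega) (self_mem_chain hm.1)
    rcases eq_of_mem_chain hm.1 hu hv hvS hwS (.inr hwj) with rfl | rfl
    · exact hh.ne_of_loopless hl rfl
    · exact hwi hv
  apply hw
  rw [hm.1.mem_cubicSet_iff]
  rcases hij with ⟨rfl, rfl⟩ | ⟨rfl, rfl⟩ <;> tauto

/-- Move the colour `3` from `e` to `h` and give `e` the colour of `h`. -/
def slide [DecidableEq β] (c : β → ℕ) (e h : β) : β → ℕ :=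
  Function.update (Function.update c h 3) e (c h)

variable [DecidableEq β]

lemma slide_left : slide c e h e = c h := by simp [slide]

lemma slide_right (hne : h ≠ e) : slide c e h h = 3 := by simp [slide, hne]

lemma slide_of_ne (h1 : f ≠ e) (h2 : f ≠ h) : slide c e h f = c f := by simp [slide, h1, h2]

lemma IsProperEdgeColoring.isProperEdgeColoring_slide (hc : G.IsProperEdgeColoring 3 c)
    (he : G.IsLink e u v) (h3 : c e = 3) (hv : G.Missing c (c h) v)
    (hh : G.IsLink h u w) (hh3 : c h ≠ 3) (hw : G.Missing c 3 w) :
    G.IsProperEdgeColoring 3 (slide c e h) := by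
  have hne : h ≠ e := by rintro rfl; exact hh3 h3
  have key1 : ∀ g x, G.Inc e x → G.Inc g x → g ≠ e → slide c e h g ≠ slide c e h e := by
    intro g x hex hgx hge
    rw [slide_left]
    rcases eq_or_ne g h with rfl | hgh
    · rw [slide_right hge]
      exact hh3.symm
    · rw [slide_of_ne hge hgh]
      rcases hex.eq_or_eq_of_isLink he with rfl | rfl
      · exact hc.2 g h x hgx hh.inc_left hgh
      · exact hv g hgx
  have key2 : ∀ g x, G.Inc h x → G.Inc g x → g ≠ h → slide c e h g ≠ slide c e h h := by
    intro g x hhx hgx hgh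
    rw [slide_right hne]
    rcases eq_or_ne g e with rfl | hge
    · rwa [slide_left]
    · rw [slide_of_ne hge hgh]
      rcases hhx.eq_or_eq_of_isLink hh with rfl | rfl
      · rw [← h3]
        exact hc.2 g e x hgx he.inc_left hge
      · exact hw g hgx
  constructor
  · intro f hf
    by_cases h1 : f = e
    · rw [h1, slide_left]
      exact hc.1 h hh.edge_mem
    · by_cases h2 : f = h
      · rw [h2, slide_right hne]
        simp
      · rw [slide_of_ne h1 h2]
        exact hc.1 f hf
  · intro f g x hf hg hfg
    by_cases h1 : f = e
    · subst h1
      exact (key1 g x hf hg hfg.symm).symm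
    by_cases h2 : g = e
    · subst h2
      exact key1 f x hg hf hfg
    by_cases h3 : f = h
    · subst h3
      exact (key2 g x hf hg hfg.symm).symm
    by_cases h4 : g = h
    · subst h4
      exact key2 f x hg hf hfg
    rw [slide_of_ne h1 h3, slide_of_ne h2 h4]
    exact hc.2 f g x hf hg hfg

lemma IsMinThreeColoring.isMinThreeColoring_slide (hm : G.IsMinThreeColoring c)
    (he : G.IsLink e u v) (h3 : c e = 3) (hv : G.Missing c (c h) v)
    (hh : G.IsLink h u w) (hh3 : c h ≠ 3) (hw : G.Missing c 3 w) :
    G.IsMinThreeColoring (slide c e h) := by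
  refine ⟨hm.1.isProperEdgeColoring_slide he h3 hv hh hh3 hw,
    fun c' hc' => le_trans (le_of_eq ?_) (hm.2 c' hc')⟩
  have hne : h ≠ e := by rintro rfl; exact hh3 h3
  have hset : {f ∈ G.edgeSet | slide c e h f = 3} =
      insert h ({f ∈ G.edgeSet | c f = 3} \ {e}) := by
    ext f
    simp only [Set.mem_ofPred_eq, Set.mem_insert_iff, Set.mem_sdiff, Set.mem_singleton_iff]
    by_cases h1 : f = e
    · subst h1
      simp [slide_left, hh3, hne.symm]
    · by_cases h2 : f = h
      · subst h2
        simp [slide_right hne, hh.edge_mem]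
      · simp [slide_of_ne h1 h2, h1, h2]
  rw [hset]
  exact Set.ncard_exchange (fun hmem => hh3 hmem.2) ⟨he.edge_mem, h3⟩

lemma missing_slide_iff (he : G.IsLink e u v) (h3 : c e = 3) (hh : G.IsLink h u w)
    (hh3 : c h ≠ 3) (hxv : x ≠ v) (hxw : x ≠ w) :
    G.Missing (slide c e h) 3 x ↔ G.Missing c 3 x := by
  have hne : h ≠ e := by rintro rfl; exact hh3 h3
  constructor
  · intro hx f hf hf3
    by_cases h1 : f = e
    · subst h1
      rcases hf.eq_or_eq_of_isLink he with rfl | rfl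
      · exact hx h hh.inc_left (slide_right hne)
      · exact hxv rfl
    · by_cases h2 : f = h
      · subst h2
        exact hh3 hf3
      · exact hx f hf (by rwa [slide_of_ne h1 h2])
  · intro hx f hf hf3
    by_cases h1 : f = e
    · subst h1
      exact hx f hf h3
    · by_cases h2 : f = h
      · subst h2
        rcases hf.eq_or_eq_of_isLink hh with rfl | rfl
        · exact hx e he.inc_left h3
        · exact hxw rfl
      · exact hx f hf (by rwa [slide_of_ne h1 h2] at hf3)

end Slide

/-! ### Recognising cycles and components -/

section Cycle

variable {α β : Type*} {G : Graph α β} {x y u : α}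

lemma isCycleOfLength_of_nat {n : ℕ} (hn : 3 ≤ n) (X : ℕ → α) (E : ℕ → β)
    (hinj : ∀ a < n, ∀ b < n, X a = X b → a = b)
    (hlink : ∀ p, p + 1 < n → G.IsLink (E p) (X p) (X (p + 1)))
    (hlast : G.IsLink (E (n - 1)) (X (n - 1)) (X 0))
    (hV : ∀ x, x ∈ G.vertexSet ↔ ∃ p < n, X p = x)
    (hE : ∀ f ∈ G.edgeSet, ∃ p < n, E p = f) : G.IsCycleOfLength n := by
  have : NeZero n := ⟨by omega⟩
  have hval : ∀ p : ZMod n, p.val < n := ZMod.val_lt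
  have hone : (1 : ZMod n).val = 1 := ZMod.val_one'' (by omega)
  have hvinj : Function.Injective fun p : ZMod n => X p.val := fun a b h =>
    ZMod.val_injective n (hinj _ (hval a) _ (hval b) h)
  have hL : ∀ p : ZMod n, G.IsLink (E p.val) (X p.val) (X (p + 1).val) := by
    intro p
    by_cases hp : p.val + 1 < n
    · rw [ZMod.val_add_of_lt (by omega), hone]
      exact hlink _ hp
    · have hp' : p.val = n - 1 := by have := hval p; omega
      have h0 : (p + 1).val = 0 := by
        rw [ZMod.val_add, hone, hp', Nat.sub_add_cancel (by omega), Nat.mod_self]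
      rw [h0, hp']
      exact hlast
  refine ⟨by omega, fun p => X p.val, fun p => E p.val, hvinj, ?_, ?_, ?_, hL⟩
  · intro a b hab
    have ha := hL a
    rw [show E a.val = E b.val from hab] at ha
    rcases ha.eq_and_eq_or_eq_and_eq (hL b) with ⟨h, -⟩ | ⟨h1, h2⟩
    · exact hvinj h
    · have h1' : a = b + 1 := hvinj h1
      have h2' : a + 1 = b := hvinj h2
      -- Equal edges traversed in opposite directions would force 2 = 0 modulo n, which is where 3 ≤
      -- n enters.
      have h3 : ((2 : ℕ) : ZMod n) = 0 := by
        rw [h1'] at h2'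
        push_cast
        linear_combination h2'
      rw [ZMod.natCast_eq_zero_iff] at h3
      have := Nat.le_of_dvd (by norm_num) h3
      omega
  · ext x
    rw [hV]
    constructor
    · rintro ⟨p, rfl⟩
      exact ⟨p.val, hval p, rfl⟩
    · rintro ⟨p, hp, rfl⟩
      exact ⟨(p : ZMod n), by simp [ZMod.val_cast_of_lt hp]⟩
  · ext f
    constructor
    · rintro ⟨p, rfl⟩
      exact (hL p).edge_mem
    · intro hf
      obtain ⟨p, hp, rfl⟩ := hE f hf
      exact ⟨(p : ZMod n), by simp [ZMod.val_cast_of_lt hp]⟩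

lemma isComponent_induce {S : Set α} (hS : S ⊆ G.vertexSet) (hu : u ∈ S)
    (hclosed : ∀ x ∈ S, ∀ y, G.Adj x y → y ∈ S)
    (hreach : ∀ x ∈ S, Relation.ReflTransGen G.Adj u x) : (G.induce S).IsComponent G := by
  have hmem : ∀ y, Relation.ReflTransGen G.Adj u y → y ∈ S := by
    intro y hy
    induction hy with
    | refl => exact hu
    | tail _ h ih => exact hclosed _ ih _ h
  have hind : ∀ y, Relation.ReflTransGen G.Adj u y →
      Relation.ReflTransGen (G.induce S).Adj u y := by
    intro y hy
    induction hy with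
    | refl => exact .refl
    | @tail b d hb h ih =>
      obtain ⟨e, he⟩ := h
      refine ih.tail ⟨e, ?_⟩
      exact ⟨he, hmem _ hb, hmem _ (hb.tail ⟨e, he⟩)⟩
  have hsymm : ∀ a b, Relation.ReflTransGen (G.induce S).Adj a b →
      Relation.ReflTransGen (G.induce S).Adj b a := by
    intro a b hab
    induction hab with
    | refl => exact .refl
    | tail _ h ih => exact .head h.symm ih
  refine ⟨⟨induce_le hS, ⟨u, hu⟩, fun a ha b hb =>
    (hsymm _ _ (hind a (hreach a ha))).trans (hind b (hreach b hb))⟩, ?_⟩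
  rintro K ⟨hKG, -, hK⟩ hle
  have huK : u ∈ K.vertexSet := hle.vertexSet_mono hu
  have hKS : ∀ y ∈ K.vertexSet, y ∈ S := fun y hy =>
    hmem y (Relation.ReflTransGen.mono (fun _ _ h => h.mono hKG) u y (hK u huK y hy))
  refine ⟨hKS, fun e a b hab => ?_⟩
  exact ⟨hab.mono hKG, hKS _ hab.left_mem, hKS _ hab.right_mem⟩

end Cycle

/-! ### Chains without cubic vertices -/

section OddCycle

variable {α β : Type*} {G : Graph α β} {c : β → ℕ} {e : β} {i j : ℕ} {x y u v : α}

lemma reflTransGen_adj_nbrPerm {t : ℕ} (hc : G.IsProperEdgeColoring t c) (i : ℕ) (x : α) :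
    Relation.ReflTransGen G.Adj x (nbrPerm hc i x) := by
  by_cases h : G.Missing c i x
  · rw [nbrPerm_apply, nbr_of_missing h]
  · obtain ⟨e, he, -⟩ := exists_isLink_nbr h
    exact .single ⟨e, he⟩

lemma reflTransGen_adj_symm (h : Relation.ReflTransGen G.Adj x y) :
    Relation.ReflTransGen G.Adj y x := by
  induction h with
  | refl => exact .refl
  | tail _ h ih => exact .head h.symm ih

lemma reflTransGen_adj_of_mem_chain {t : ℕ} (hc : G.IsProperEdgeColoring t c)
    (hx : x ∈ chain hc i j u) : Relation.ReflTransGen G.Adj u x := by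
  obtain ⟨k, rfl⟩ := hx
  have hstep : ∀ y, Relation.ReflTransGen G.Adj y ((nbrPerm hc j * nbrPerm hc i) y) := fun y =>
    (reflTransGen_adj_nbrPerm hc i y).trans (reflTransGen_adj_nbrPerm hc j _)
  induction k using Int.induction_on with
  | zero => simpa using .refl
  | succ k ih =>
    simp only [add_comm (k : ℤ) 1, zpow_add, zpow_one]
    exact ih.trans (hstep _)
  | pred k ih =>
    refine ih.trans (reflTransGen_adj_symm ?_)
    have := hstep (((nbrPerm hc j * nbrPerm hc i) ^ (-(k : ℤ) - 1)) u)
    rwa [← Equiv.Perm.mul_apply, ← zpow_one_add, add_sub_cancel] at this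

/-- The enumeration `0, -1, 1, -2, 2, …` of the integers. -/
def zigzag (p : ℕ) : ℤ := if p % 2 = 0 then ((p / 2 : ℕ) : ℤ) else -(((p + 1) / 2 : ℕ) : ℤ)

/-- If the Kempe chain of an edge of colour `3` has no cubic vertex, then the edge lies in a
component that is an odd cycle. -/
lemma IsMinThreeColoring.exists_isOddCycle (hE : G.edgeSet.Finite) (hl : G.Loopless)
    (hm : G.IsMinThreeColoring c) (hij : (i = 1 ∧ j = 2) ∨ (i = 2 ∧ j = 1))
    (he : G.IsLink e u v) (h3 : c e = 3) (hu : G.Missing c j u) (hv : G.Missing c i v)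
    (hS : ∀ x ∈ chain hm.1 i j u, x ∉ G.cubicSet) :
    ∃ H : Graph α β, H.IsComponent G ∧ H.IsOddCycle := by
  have hc := hm.1
  have hkc := kempeClosed_chain hc hij hu
  have huS : u ∈ chain hc i j u := self_mem_chain hc
  have hvS := hm.mem_chain hE hij he h3 hu hv
  have hSV : chain hc i j u ⊆ G.vertexSet := by
    intro x hx
    rcases (reflTransGen_adj_of_mem_chain hc hx).cases_tail with rfl | ⟨y, -, hy⟩
    · exact he.left_mem
    · exact hy.right_mem
  -- A non-cubic vertex with an edge of colour 3 misses 1 or 2, so on the chain it must be u or v.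
  have hthree : ∀ f x, x ∈ chain hc i j u → G.Inc f x → c f = 3 → f = e := by
    intro f x hx hf hf3
    have := hc.exists_missing (hS x hx) hf hf3
    rcases eq_of_mem_chain hc hu hv hvS hx (by rcases hij with ⟨rfl, rfl⟩ | ⟨rfl, rfl⟩ <;> tauto)
      with rfl | rfl
    · exact hc.eq_of_inc hf he.inc_left (hf3.trans h3.symm)
    · exact hc.eq_of_inc hf he.inc_right (hf3.trans h3.symm)
  have hcomp : (G.induce (chain hc i j u)).IsComponent G := by
    refine isComponent_induce hSV huS ?_ fun x hx => reflTransGen_adj_of_mem_chain hc hx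
    rintro x hx y ⟨f, hf⟩
    by_cases hf3 : c f = 3
    · obtain rfl := hthree f x hx hf.inc_left hf3
      rcases hf.right_eq_or_eq he with rfl | rfl <;> assumption
    · exact hkc f x y hf hf3 hx
  refine ⟨_, hcomp, ?_⟩
  obtain ⟨k, hk⟩ := hvS
  set s := nbrPerm hc i
  set t := nbrPerm hc j
  have hs : s * s = 1 := nbrPerm_mul_self hc i
  have ht : t * t = 1 := nbrPerm_mul_self hc j
  have htu : t u = u := nbr_of_missing hu
  have hk' : ((t * s) ^ k) u = v := hk
  have hsv : s (((t * s) ^ k) u) = ((t * s) ^ k) u := by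
    rw [hk']
    exact nbr_of_missing hv
  have hdvd := minimalPeriod_dvd_of_fixed' hs ht htu hsv
  set n := Function.minimalPeriod (t * s) u
  have hper : ∀ a b : ℤ, ((t * s) ^ a) u = ((t * s) ^ b) u ↔ (n : ℤ) ∣ a - b :=
    fun a b => zpow_apply_eq_iff a b
  have hnS : ∀ x ∈ chain hc i j u, x ≠ v → ∃ f, G.IsLink f x (s x) ∧ c f = i := by
    rintro _ ⟨l, rfl⟩ hx
    refine exists_isLink_nbr fun hmiss => hx ?_
    rw [← hk']
    exact eq_of_fixed' hs ht htu hsv (nbr_of_missing hmiss)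
  have hnT : ∀ x ∈ chain hc i j u, x ≠ u → ∃ f, G.IsLink f x (t x) ∧ c f = j := by
    rintro _ ⟨l, rfl⟩ hx
    refine exists_isLink_nbr fun hmiss => hx ?_
    exact eq_of_fixed hs ht htu hsv (nbr_of_missing hmiss)
  have hn0 : n % 2 = 1 := by
    obtain ⟨a, ha⟩ := hdvd
    by_contra hcon
    have h2 : (2 : ℤ) ∣ n := by omega
    have : (2 : ℤ) ∣ 2 * k + 1 := ha ▸ h2.mul_right a
    omega
  obtain ⟨m, hm2⟩ : ∃ m, n = 2 * m + 1 := ⟨n / 2, by omega⟩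
  -- Modulo n, 2k = -1 = 2m, and 2 is invertible. So v is the vertex reached last in the zigzag
  -- order.
  have hXv : ((t * s) ^ (m : ℤ)) u = v := by
    rw [← hk', hper]
    have h1 : (n : ℤ) ∣ 2 * (m - k) := by
      have := dvd_sub (dvd_refl (n : ℤ)) hdvd
      rwa [show (n : ℤ) - (2 * k + 1) = 2 * (m - k) by rw [hm2]; push_cast; ring] at this
    refine IsCoprime.dvd_of_dvd_mul_left (y := (2 : ℤ)) ?_ h1
    exact ⟨1, -m, by rw [hm2]; push_cast; ring⟩
  have hm0 : m ≠ 0 := by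
    rintro rfl
    exact he.ne_of_loopless hl (by simpa using hXv)
  have hz : ∀ p, zigzag p = if p % 2 = 0 then ((p / 2 : ℕ) : ℤ) else -(((p + 1) / 2 : ℕ) : ℤ) :=
    fun _ => rfl
  -- On exponents s acts as k ↦ -k - 1 and t as k ↦ -k, so walking from u with s and t alternately
  -- runs through `zigzag`. For indices below n = 2m + 1 it stays in [-m, m], so differences are
  -- smaller than n in absolute value.
  have hinj : ∀ a < n, ∀ b < n,
      ((t * s) ^ zigzag a) u = ((t * s) ^ zigzag b) u → a = b := by
    intro a ha b hb hab
    rw [hper] at hab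
    have hza := hz a
    have hzb := hz b
    have := Int.eq_zero_of_abs_lt_dvd hab (by rw [abs_lt]; split_ifs at hza hzb <;> omega)
    split_ifs at hza hzb <;> omega
  have hX0 : ((t * s) ^ zigzag 0) u = u := by simp [zigzag]
  have hXlast : ((t * s) ^ zigzag (2 * m)) u = v := by
    rw [← hXv, hz, if_pos (by omega)]
    congr 3
    omega
  have hXS : ∀ p, ((t * s) ^ zigzag p) u ∈ chain hc i j u := fun p => ⟨_, rfl⟩
  have hedge : ∀ p, ∃ f, (p + 1 < n → G.IsLink f (((t * s) ^ zigzag p) u)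
      (((t * s) ^ zigzag (p + 1)) u) ∧ c f = if p % 2 = 0 then i else j) ∧
      (p + 1 = n → f = e) := by
    intro p
    by_cases hp : p + 1 < n
    · by_cases hp2 : p % 2 = 0
      · obtain ⟨f, hf, hfi⟩ := hnS _ (hXS p) fun h => by
          have := hinj p (by omega) (2 * m) (by omega) (h.trans hXlast.symm)
          omega
        refine ⟨f, fun _ => ⟨?_, by rw [if_pos hp2, hfi]⟩, by omega⟩
        rw [apply_zpow_of_fixed' hs ht htu] at hf
        have h1 := hz p
        have h2 := hz (p + 1)
        rw [if_pos (by omega)] at h1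
        rw [if_neg (by omega)] at h2
        rwa [show zigzag (p + 1) = -zigzag p - 1 by omega]
      · obtain ⟨f, hf, hfi⟩ := hnT _ (hXS p) fun h => by
          have := hinj p (by omega) 0 (by omega) (h.trans hX0.symm)
          omega
        refine ⟨f, fun _ => ⟨?_, by rw [if_neg hp2, hfi]⟩, by omega⟩
        rw [apply_zpow_of_fixed hs ht htu] at hf
        have h1 := hz p
        have h2 := hz (p + 1)
        rw [if_neg (by omega)] at h1
        rw [if_pos (by omega)] at h2
        rwa [show zigzag (p + 1) = -zigzag p by omega]
    · exact ⟨e, fun h => absurd h hp, fun _ => rfl⟩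
  choose E hE1 hE2 using hedge
  -- A residue r ≤ m is the exponent at index 2r; a larger one is represented by the negative
  -- exponent r - n, at index 2(n - r) - 1.
  have hsurj : ∀ x ∈ chain hc i j u, ∃ p < n, ((t * s) ^ zigzag p) u = x := by
    rintro _ ⟨l, rfl⟩
    have hn0' : (0 : ℤ) < n := by omega
    have h1 := Int.emod_nonneg l hn0'.ne'
    have h2 := Int.emod_lt_of_pos l hn0'
    have h3 := Int.emod_add_mul_ediv l n
    obtain ⟨r, hr⟩ := Int.eq_ofNat_of_zero_le h1
    by_cases hrm : r ≤ m
    · refine ⟨2 * r, by omega, (hper _ _).2 ⟨-(l / n), ?_⟩⟩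
      rw [hz, if_pos (by omega), show 2 * r / 2 = r by omega]
      linear_combination h3 - hr
    · refine ⟨2 * (n - r) - 1, by omega, (hper _ _).2 ⟨-(l / n) - 1, ?_⟩⟩
      rw [hz, if_neg (by omega), show (2 * (n - r) - 1 + 1) / 2 = n - r by omega,
        Nat.cast_sub (by omega)]
      linear_combination h3 - hr
  refine ⟨n, Nat.odd_iff.2 hn0, isCycleOfLength_of_nat (by omega)
    (fun p => ((t * s) ^ zigzag p) u) E hinj ?_ ?_ ?_ ?_⟩
  · intro p hp
    exact ⟨(hE1 p hp).1, hXS _, hXS _⟩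
  · refine ⟨?_, hXS _, hXS _⟩
    rw [hE2 (n - 1) (by omega), show n - 1 = 2 * m by omega, hXlast, hX0]
    exact he.symm
  · intro x
    exact ⟨fun hx => hsurj x hx, by rintro ⟨p, -, rfl⟩; exact hXS p⟩
  · rintro f ⟨x, y, hf, hx, -⟩
    by_cases hf3 : c f = 3
    · exact ⟨n - 1, by omega, by rw [hE2 _ (by omega), hthree f x hx hf.inc_left hf3]⟩
    obtain ⟨p, hp, rfl⟩ := hsurj x hx
    have hcol := hc.color_cases hf.inc_left
    have hnext : p + 1 < n → (c f = if p % 2 = 0 then i else j) → E p = f := fun h1 h2 =>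
      hc.eq_of_inc (hE1 p h1).1.inc_left hf.inc_left ((hE1 p h1).2.trans h2.symm)
    have hprev : p ≠ 0 → (c f = if p % 2 = 0 then j else i) → E (p - 1) = f := by
      intro h1 h2
      have h := hE1 (p - 1) (by omega)
      rw [Nat.sub_add_cancel (by omega)] at h
      refine hc.eq_of_inc h.1.inc_right hf.inc_left ?_
      rw [h.2, h2]
      split_ifs <;> omega
    by_cases hA : c f = if p % 2 = 0 then i else j
    · by_cases hpn : p + 1 < n
      · exact ⟨p, hp, hnext hpn hA⟩
      · obtain rfl : p = 2 * m := by omega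
        rw [if_pos (by omega)] at hA
        rw [hXlast] at hf
        exact absurd hA (hv f hf.inc_left)
    · have hB : c f = if p % 2 = 0 then j else i := by split_ifs at hA ⊢ <;> omega
      by_cases hp0 : p = 0
      · subst hp0
        rw [hX0] at hf
        exact absurd (by simpa using hB) (hu f hf.inc_left)
      · exact ⟨p - 1, by omega, hprev hp0 hB⟩

end OddCycle

/-! ### Existence of repairing edges -/

section Distance

variable {α β : Type*} {G : Graph α β} {c : β → ℕ} {e : β} {i j : ℕ} {x y u v : α}

/-- The vertices that are joined to a cubic vertex by a walk of length `n`. -/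
def layer (G : Graph α β) : ℕ → Set α
  | 0 => G.cubicSet
  | n + 1 => {x | ∃ y ∈ layer G n, G.Adj x y}

/-- The distance to the set of cubic vertices. -/
noncomputable def cubicDist (G : Graph α β) (x : α) : ℕ := sInf {n | x ∈ G.layer n}

lemma exists_mem_layer (h : Relation.ReflTransGen G.Adj x y) (hy : y ∈ G.cubicSet) :
    ∃ n, x ∈ G.layer n := by
  induction h using Relation.ReflTransGen.head_induction_on with
  | refl => exact ⟨0, hy⟩
  | head h _ ih =>
    obtain ⟨n, hn⟩ := ih
    exact ⟨n + 1, _, hn, h⟩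

/-- Reachability is assumed because `cubicDist` is 0 by default where no cubic vertex can be
reached. -/
lemma exists_adj_cubicDist_lt (hx : ∃ n, x ∈ G.layer n) (hxT : x ∉ G.cubicSet) :
    ∃ y, G.Adj x y ∧ G.cubicDist y < G.cubicDist x := by
  have hmem : x ∈ G.layer (G.cubicDist x) := Nat.sInf_mem hx
  match hd : G.cubicDist x with
  | 0 =>
    rw [hd] at hmem
    exact absurd hmem hxT
  | n + 1 =>
    rw [hd] at hmem
    obtain ⟨y, hy, hxy⟩ := hmem
    exact ⟨y, hxy, Nat.lt_succ_of_le (Nat.sInf_le hy)⟩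

lemma IsMinThreeColoring.exists_mem_layer (hE : G.edgeSet.Finite) (hl : G.Loopless)
    (hodd : ∀ H : Graph α β, H.IsComponent G → ¬ H.IsOddCycle) (hm : G.IsMinThreeColoring c)
    (he : G.IsLink e u v) (h3 : c e = 3) (hu : u ∉ G.cubicSet) (hv : v ∉ G.cubicSet) :
    ∃ n, u ∈ G.layer n := by
  obtain ⟨i, j, hij, hju, hiv, -⟩ := hm.exists_colors hE he h3 hu hv
  by_contra hn
  obtain ⟨H, hH, hHodd⟩ := hm.exists_isOddCycle hE hl hij he h3 hju hiv fun x hx hxT =>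
    hn (Graph.exists_mem_layer (reflTransGen_adj_of_mem_chain hm.1 hx) hxT)
  exact hodd H hH hHodd

open Classical in
/-- The sum of the distances to the cubic vertices over the ends of the edges of colour `3`. -/
noncomputable def potential (G : Graph α β) (hV : G.vertexSet.Finite) (c : β → ℕ) : ℕ :=
  ∑ x ∈ hV.toFinset with ¬ G.Missing c 3 x, G.cubicDist x

/-- `e` joins two non-cubic vertices, one of which is joined to a cubic vertex by `h`. -/
def IsRepair (G : Graph α β) (e h : β) : Prop :=
  ∃ u v w, G.IsLink e u v ∧ u ∉ G.cubicSet ∧ v ∉ G.cubicSet ∧ G.IsLink h u w ∧ w ∈ G.cubicSet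

/-- Step from the nearer end u to a neighbour w closer still. If w were not cubic, sliding colour 3
from uv to uw would keep minimality and lower the potential. -/
lemma IsMinThreeColoring.exists_isRepair_of_le (hV : G.vertexSet.Finite) (hE : G.edgeSet.Finite)
    (hl : G.Loopless) (hodd : ∀ H : Graph α β, H.IsComponent G → ¬ H.IsOddCycle)
    (hm : G.IsMinThreeColoring c)
    (hpot : ∀ c', G.IsMinThreeColoring c' → G.potential hV c ≤ G.potential hV c')
    (he : G.IsLink e u v) (h3 : c e = 3) (hu : u ∉ G.cubicSet) (hv : v ∉ G.cubicSet)
    (hle : G.cubicDist u ≤ G.cubicDist v) : ∃ h, G.IsRepair e h := by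
  classical
  obtain ⟨i, j, hij, hju, hiv, -⟩ := hm.exists_colors hE he h3 hu hv
  obtain ⟨w, ⟨h, hh⟩, hlt⟩ :=
    exists_adj_cubicDist_lt (hm.exists_mem_layer hE hl hodd he h3 hu hv) hu
  have hwv : w ≠ v := by
    rintro rfl
    omega
  have hne : h ≠ e := by
    rintro rfl
    exact hwv (hh.right_unique he)
  have hh3 : c h ≠ 3 := fun h3' => hne (hm.1.eq_of_inc hh.inc_left he.inc_left (h3'.trans h3.symm))
  have hhi : c h = i := by
    have := hm.1.color_cases hh.inc_left
    have := hju h hh.inc_left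
    omega
  refine ⟨h, u, v, w, he, hu, hv, hh, by_contra fun hw => ?_⟩
  have hw3 := hm.missing_three hE hl hij he h3 hju hiv hh hhi hw
  have hle' := hpot _ (hm.isMinThreeColoring_slide he h3 (by rwa [hhi]) hh hh3 hw3)
  have hv3 : G.Missing (slide c e h) 3 v := by
    intro f hf hf3
    by_cases h1 : f = e
    · subst h1
      rw [slide_left] at hf3
      exact hh3 hf3
    · by_cases h2 : f = h
      · subst h2
        rcases hf.eq_or_eq_of_isLink hh with rfl | rfl
        · exact he.ne_of_loopless hl rfl
        · exact hwv rfl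
      · rw [slide_of_ne h1 h2] at hf3
        exact h1 (hm.1.eq_of_inc hf he.inc_right (hf3.trans h3.symm))
  have hwn : ¬ G.Missing (slide c e h) 3 w := fun hmiss => hmiss h hh.inc_right (slide_right hne)
  have hvn : ¬ G.Missing c 3 v := fun hmiss => hmiss e he.inc_right h3
  set A := hV.toFinset.filter fun x => ¬ G.Missing c 3 x with hA
  -- The slide replaces v by w among the vertices that have colour 3, and w is strictly closer than
  -- v.
  have hA' : (hV.toFinset.filter fun x => ¬ G.Missing (slide c e h) 3 x) =
      insert w (A.erase v) := by
    ext x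
    simp only [hA, Finset.mem_filter, Finset.mem_insert, Finset.mem_erase, Set.Finite.mem_toFinset]
    by_cases hxv : x = v
    · subst hxv
      simp [hv3, hwv.symm]
    · by_cases hxw : x = w
      · subst hxw
        simp [hwn, hh.right_mem]
      · simp [missing_slide_iff he h3 hh hh3 hxv hxw, hxv, hxw]
  have hvA : v ∈ A := by simp [hA, hvn, he.right_mem]
  have hwA : w ∉ A.erase v := by simp [hA, hw3]
  rw [potential, potential, hA', Finset.sum_insert hwA, ← hA, ← Finset.add_sum_erase _ _ hvA] at hle'
  omega

lemma exists_forall_le {ι : Type*} {p : ι → Prop} (f : ι → ℕ) (h : ∃ a, p a) :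
    ∃ a, p a ∧ ∀ b, p b → f a ≤ f b := by
  obtain ⟨a, ha, hmin⟩ := (measure f).wf.has_min {a | p a} h
  exact ⟨a, ha, fun b hb => not_lt.1 (hmin b hb)⟩

lemma exists_isMinThreeColoring_isRepair (hV : G.vertexSet.Finite) (hE : G.edgeSet.Finite)
    (hl : G.Loopless) (hodd : ∀ H : Graph α β, H.IsComponent G → ¬ H.IsOddCycle)
    (hcol : ∃ c, G.IsProperEdgeColoring 3 c) :
    ∃ c, G.IsMinThreeColoring c ∧ ∀ e u v, G.IsLink e u v → c e = 3 → u ∉ G.cubicSet →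
      v ∉ G.cubicSet → ∃ h, G.IsRepair e h := by
  obtain ⟨c₀, hc₀⟩ := exists_forall_le (fun c => {e ∈ G.edgeSet | c e = 3}.ncard) hcol
  obtain ⟨c, hm, hpot⟩ := exists_forall_le (p := G.IsMinThreeColoring) (G.potential hV) ⟨c₀, hc₀⟩
  refine ⟨c, hm, fun e u v he h3 hu hv => ?_⟩
  rcases le_total (G.cubicDist u) (G.cubicDist v) with hle | hle
  · exact hm.exists_isRepair_of_le hV hE hl hodd hpot he h3 hu hv hle
  · exact hm.exists_isRepair_of_le hV hE hl hodd hpot he.symm h3 hv hu hle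

end Distance

/-! ### Repair sets and removal of conflicts -/

section Repair

variable {α β : Type*} {G : Graph α β} {c : β → ℕ} {e f h h' m : β} {i j : ℕ}
  {x y z u v w : α} {P S : Set β}

lemma IsRepair.ne (hr : G.IsRepair e h) : h ≠ e := by
  rintro rfl
  obtain ⟨u, v, w, he, -, hv, hh, hw⟩ := hr
  exact hv (hh.right_unique he ▸ hw)

/-- The edge h determines its non-cubic end, which carries only one edge of colour 3. -/
lemma IsRepair.unique_left {e' : β} (hc : G.IsProperEdgeColoring 3 c) (hr : G.IsRepair e h)
    (hr' : G.IsRepair e' h) (h3 : c e = 3) (h3' : c e' = 3) : e = e' := by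
  obtain ⟨u, v, w, he, hu, hv, hh, hw⟩ := hr
  obtain ⟨u', v', w', he', hu', hv', hh', hw'⟩ := hr'
  rcases hh.left_eq_or_eq hh' with rfl | rfl
  · exact hc.eq_of_inc he.inc_left he'.inc_left (h3.trans h3'.symm)
  · exact absurd hw' hu

lemma IsRepair.color_ne_three (hc : G.IsProperEdgeColoring 3 c) (hr : G.IsRepair e h)
    (h3 : c e = 3) : c h ≠ 3 := by
  intro hh3
  have hne := hr.ne
  obtain ⟨u, v, w, he, hu, hv, hh, hw⟩ := hr
  exact hne (hc.eq_of_inc hh.inc_left he.inc_left (hh3.trans h3.symm))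

lemma IsRepair.eq_of_mem_cubicSet (hr : G.IsRepair e h) (hx : G.Inc h x) (hy : G.Inc h y)
    (hxT : x ∈ G.cubicSet) (hyT : y ∈ G.cubicSet) : x = y := by
  obtain ⟨u, v, w, he, hu, hv, hh, hw⟩ := hr
  rcases hx.eq_or_eq_of_isLink hh with rfl | rfl
  · exact absurd hxT hu
  · rcases hy.eq_or_eq_of_isLink hh with rfl | rfl
    · exact absurd hyT hu
    · rfl

/-- `P` contains exactly one repairing edge for every edge of colour `3` that joins two non-cubic
vertices, and no other edges. -/
structure IsRepairSet (G : Graph α β) (c : β → ℕ) (P : Set β) : Prop where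
  exists_isRepair : ∀ h ∈ P, ∃ e, c e = 3 ∧ G.IsRepair e h
  unique : ∀ e, c e = 3 → ∀ h ∈ P, ∀ h' ∈ P, G.IsRepair e h → G.IsRepair e h' → h = h'
  exists_mem : ∀ e u v, G.IsLink e u v → c e = 3 → u ∉ G.cubicSet → v ∉ G.cubicSet →
    ∃ h ∈ P, G.IsRepair e h

lemma exists_isRepairSet (hc : G.IsProperEdgeColoring 3 c)
    (hex : ∀ e u v, G.IsLink e u v → c e = 3 → u ∉ G.cubicSet → v ∉ G.cubicSet →
      ∃ h, G.IsRepair e h) : ∃ P, G.IsRepairSet c P := by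
  classical
  let r : β → β := fun e => if he : ∃ h, G.IsRepair e h then he.choose else e
  have hr : ∀ e, (∃ h, G.IsRepair e h) → G.IsRepair e (r e) := fun e he => by
    simp only [r, dif_pos he]
    exact he.choose_spec
  refine ⟨{h | ∃ e, c e = 3 ∧ r e = h ∧ G.IsRepair e h}, ?_, ?_, ?_⟩
  · rintro h ⟨e, h3, -, he⟩
    exact ⟨e, h3, he⟩
  · rintro e h3 _ ⟨e₁, h31, rfl, hr1⟩ _ ⟨e₂, h32, rfl, hr2⟩ h1 h2
    rw [hr1.unique_left hc h1 h31 h3, hr2.unique_left hc h2 h32 h3]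
  · intro e u v he h3 hu hv
    have := hr e (hex e u v he h3 hu hv)
    exact ⟨r e, ⟨e, h3, rfl, this⟩, this⟩

lemma IsRepair.edge_mem (hr : G.IsRepair e h) : e ∈ G.edgeSet := by
  obtain ⟨u, v, w, he, -⟩ := hr
  exact he.edge_mem

lemma IsRepairSet.congr {c' : β → ℕ} (hP : G.IsRepairSet c P)
    (hcc : ∀ e ∈ G.edgeSet, (c' e = 3 ↔ c e = 3)) : G.IsRepairSet c' P where
  exists_isRepair h hh := by
    obtain ⟨e, h3, hr⟩ := hP.exists_isRepair h hh
    exact ⟨e, (hcc e hr.edge_mem).2 h3, hr⟩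
  unique e h3 h hh h' hh' hr hr' := hP.unique e ((hcc e hr.edge_mem).1 h3) h hh h' hh' hr hr'
  exists_mem e u v he h3 hu hv := hP.exists_mem e u v he ((hcc e he.edge_mem).1 h3) hu hv

/-- The Kempe chain that belongs to a repairing edge. -/
lemma IsRepairSet.exists_kempeClosed (hE : G.edgeSet.Finite) (hm : G.IsMinThreeColoring c)
    (hP : G.IsRepairSet c P) (hh : h ∈ P) :
    ∃ S, G.KempeClosed c S ∧ (∀ x, G.Inc h x → x ∈ S) ∧
      (∀ h' ∈ P, ∀ a ∈ S, G.Inc h' a → h' = h) ∧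
      ∀ m a b, G.IsLink m a b → c m = 3 → a ∈ S → a ∉ G.cubicSet → b ∈ S ∧ b ∉ G.cubicSet := by
  obtain ⟨e, h3, hr⟩ := hP.exists_isRepair h hh
  have hh3 := hr.color_ne_three hm.1 h3
  have hr₀ := hr
  obtain ⟨u, v, w, he, hu, hv, hhl, hw⟩ := hr
  obtain ⟨S, hS, huS, hvS, huv⟩ := hm.exists_kempeClosed hE he h3 hu hv
  have hend : ∀ m a b, G.IsLink m a b → c m = 3 → a ∈ S → a ∉ G.cubicSet → m = e := by
    intro m a b hmab hm3 ha haT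
    rcases huv a ha (hm.1.exists_missing haT hmab.inc_left hm3) with rfl | rfl
    · exact hm.1.eq_of_inc hmab.inc_left he.inc_left (hm3.trans h3.symm)
    · exact hm.1.eq_of_inc hmab.inc_left he.inc_right (hm3.trans h3.symm)
  refine ⟨S, hS, ?_, ?_, ?_⟩
  · intro x hx
    rcases hx.eq_or_eq_of_isLink hhl with rfl | rfl
    · exact huS
    · exact hS h u _ hhl hh3 huS
  · intro h' hh' a ha hinc
    obtain ⟨e', h3', hr'⟩ := hP.exists_isRepair h' hh'
    have hh3' := hr'.color_ne_three hm.1 h3'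
    have hr₀' := hr'
    obtain ⟨u', v', w', he', hu', hv', hhl', hw'⟩ := hr'
    have hu'S : u' ∈ S := by
      rcases hinc.eq_or_eq_of_isLink hhl' with rfl | rfl
      · exact ha
      · exact hS h' _ u' hhl'.symm hh3' ha
    obtain rfl := hend e' u' v' he' h3' hu'S hu'
    exact hP.unique e' h3' h' hh' h hh hr₀' hr₀
  · intro m a b hmab hm3 ha haT
    obtain rfl := hend m a b hmab hm3 ha haT
    rcases hmab.right_eq_or_eq he with rfl | rfl
    · exact ⟨huS, hu⟩
    · exact ⟨hvS, hv⟩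

/-- Every edge of colour `i` at `x` is a repairing edge. -/
def Lacks (G : Graph α β) (c : β → ℕ) (P : Set β) (i : ℕ) (x : α) : Prop :=
  ∀ f, G.Inc f x → f ∉ P → c f ≠ i

/-- Apart from the repairing edges, `x` has one of the colours `1` and `2` but not `i`. -/
def Wants (G : Graph α β) (c : β → ℕ) (P : Set β) (i : ℕ) (x : α) : Prop :=
  G.Lacks c P i x ∧ ¬ G.Lacks c P (3 - i) x

/-- With h in P, the vertex x would have the repaired edge of colour 3, the edge h, and the edge
outside P of colour 3 - i that wanting i requires: all three colours, making it cubic. -/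
lemma IsRepairSet.notMem_of_wants (hc : G.IsProperEdgeColoring 3 c) (hP : G.IsRepairSet c P)
    (hi : i = 1 ∨ i = 2) (hw : G.Wants c P i x) (hx : x ∉ G.cubicSet) (hh : G.Inc h x) :
    h ∉ P := by
  intro hhP
  obtain ⟨e, h3, hr⟩ := hP.exists_isRepair h hhP
  have hh3 := hr.color_ne_three hc h3
  obtain ⟨u, v, w, he, hu, hv, hhl, hwT⟩ := hr
  obtain rfl : x = u := by
    rcases hh.eq_or_eq_of_isLink hhl with rfl | rfl
    · rfl
    · exact absurd hwT hx
  have h2 := hw.2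
  simp only [Lacks, not_forall, not_not] at h2
  obtain ⟨f, hf, hfP, hfi⟩ := h2
  have hne : c h ≠ c f := hc.2 h f x hh hf (by rintro rfl; exact hfP hhP)
  apply hx
  rw [hc.mem_cubicSet_iff]
  have hcol := hc.color_cases hh
  have hm3 : ¬ G.Missing c 3 x := fun hmiss => hmiss e he.inc_left h3
  rcases hi with rfl | rfl
  · exact ⟨fun hmiss => hmiss h hh (by omega), fun hmiss => hmiss f hf hfi, hm3⟩
  · exact ⟨fun hmiss => hmiss f hf hfi, fun hmiss => hmiss h hh (by omega), hm3⟩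

lemma exists_mem_of_wants (hc : G.IsProperEdgeColoring 3 c) (hi : i = 1 ∨ i = 2)
    (hw : G.Wants c P i x) (hx : x ∈ G.cubicSet) : ∃ h ∈ P, G.Inc h x ∧ c h = i := by
  rw [hc.mem_cubicSet_iff] at hx
  have : ¬ G.Missing c i x := by rcases hi with rfl | rfl <;> tauto
  simp only [Missing, not_forall, not_not] at this
  obtain ⟨h, hh, hhi⟩ := this
  exact ⟨h, by_contra fun hhP => hw.1 h hh hhP hhi, hh, hhi⟩

section Flip

variable {S : Set α}

lemma lacks_flip_of_notMem (hS : G.KempeClosed c S) (hx : x ∉ S) :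
    G.Lacks (G.flip c S) P i x ↔ G.Lacks c P i x := by
  refine forall₂_congr fun f hf => ?_
  rw [hS.flip_of_notMem hf hx]

lemma lacks_flip_of_mem (hc : G.IsProperEdgeColoring 3 c) (hi : i = 1 ∨ i = 2) (hx : x ∈ S) :
    G.Lacks (G.flip c S) P i x ↔ G.Lacks c P (3 - i) x := by
  refine forall₂_congr fun f hf => imp_congr_right fun _ => ?_
  have := hc.color_cases hf
  by_cases h3 : c f = 3
  · rw [flip_of_eq_three h3]
    omega
  · rw [flip_of_mem hf hx h3]
    omega

lemma wants_flip_of_notMem (hS : G.KempeClosed c S) (hx : x ∉ S) :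
    G.Wants (G.flip c S) P i x ↔ G.Wants c P i x := by
  rw [Wants, Wants, lacks_flip_of_notMem hS hx, lacks_flip_of_notMem hS hx]

lemma wants_flip_of_mem (hc : G.IsProperEdgeColoring 3 c) (hi : i = 1 ∨ i = 2) (hx : x ∈ S) :
    G.Wants (G.flip c S) P i x ↔ G.Wants c P (3 - i) x := by
  rw [Wants, Wants, lacks_flip_of_mem hc hi hx, lacks_flip_of_mem hc (by omega) hx]

end Flip

/-- `m` has colour `3`, and its ends want different colours. -/
def IsConflict (G : Graph α β) (c : β → ℕ) (P : Set β) (m : β) : Prop :=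
  c m = 3 ∧ ∃ y z, G.IsLink m y z ∧ G.Wants c P 1 y ∧ G.Wants c P 2 z

/-- S is the chain of the repairing edge h at y. It meets no other edge of P and h has only one
cubic end, so y is the only cubic vertex of S that wants a colour. -/
lemma IsRepairSet.exists_flip_of_conflict (hE : G.edgeSet.Finite) (hl : G.Loopless)
    (hm : G.IsMinThreeColoring c) (hP : G.IsRepairSet c P) (hi : i = 1 ∨ i = 2)
    (hyz : G.IsLink m y z) (h3 : c m = 3) (hy : G.Wants c P i y) (hz : G.Wants c P (3 - i) z)
    (hyT : y ∈ G.cubicSet) :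
    ∃ S, G.KempeClosed c S ∧ (∀ f, G.IsConflict (G.flip c S) P f → G.IsConflict c P f) ∧
      ¬ G.IsConflict (G.flip c S) P m := by
  obtain ⟨h, hhP, hhy, -⟩ := exists_mem_of_wants hm.1 hi hy hyT
  obtain ⟨e, he3, hr⟩ := hP.exists_isRepair h hhP
  obtain ⟨S, hS, hhS, huniq, hend⟩ := hP.exists_kempeClosed hE hm hhP
  have hyS := hhS y hhy
  have heq : ∀ a k, (k = 1 ∨ k = 2) → a ∈ S → a ∈ G.cubicSet → G.Wants c P k a → a = y := by
    intro a k hk ha haT hwa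
    obtain ⟨h', hh'P, hh'a, -⟩ := exists_mem_of_wants hm.1 hk hwa haT
    obtain rfl := huniq h' hh'P a ha hh'a
    exact hr.eq_of_mem_cubicSet hh'a hhy haT hyT
  -- A non-cubic z in S would make y, the other end of its edge of colour 3, non-cubic too.
  have hzS : z ∉ S := by
    intro hzS
    by_cases hzT : z ∈ G.cubicSet
    · exact hyz.ne_of_loopless hl (heq z _ (by omega) hzS hzT hz).symm
    · exact (hend m z y hyz.symm h3 hzS hzT).2 hyT
  -- An edge of colour 3 leaving S has its inner end cubic. If that end wants a colour it is y, and
  -- the edge is m; after the flip y wants the same as z.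
  have hmix : ∀ f a b k, (k = 1 ∨ k = 2) → G.IsLink f a b → c f = 3 → a ∈ S → b ∉ S →
      G.Wants (G.flip c S) P k a → ¬ G.Wants (G.flip c S) P (3 - k) b := by
    intro f a b k hk hab hf3 ha hb hwa hwb
    rw [wants_flip_of_mem hm.1 hk ha] at hwa
    rw [wants_flip_of_notMem hS hb] at hwb
    by_cases haT : a ∈ G.cubicSet
    · obtain rfl := heq a _ (by omega) ha haT hwa
      obtain rfl := hm.1.eq_of_inc hab.inc_left hyz.inc_left (hf3.trans h3.symm)
      obtain rfl := hab.right_unique hyz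
      rcases eq_or_ne i k with rfl | hne
      · exact hy.2 hwa.1
      · obtain rfl : i = 3 - k := by omega
        exact hz.2 ((show 3 - k = 3 - (3 - (3 - k)) by omega) ▸ hwb.1)
    · exact hb (hend f a b hab hf3 ha haT).1
  have hthree : ∀ f a b, G.IsLink f a b → G.flip c S f = 3 → c f = 3 := fun f a b hab hf3 =>
    (hm.1.flip_eq_three_iff hab.edge_mem).1 hf3
  refine ⟨S, hS, ?_, ?_⟩
  · rintro f ⟨hf3, a, b, hab, ha, hb⟩
    have hf3' := hthree f a b hab hf3
    refine ⟨hf3', ?_⟩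
    by_cases haS : a ∈ S <;> by_cases hbS : b ∈ S
    · rw [wants_flip_of_mem hm.1 (by omega) haS] at ha
      rw [wants_flip_of_mem hm.1 (by omega) hbS] at hb
      exact ⟨b, a, hab.symm, hb, ha⟩
    · exact absurd hb (hmix f a b 1 (by omega) hab hf3' haS hbS ha)
    · exact absurd ha (hmix f b a 2 (by omega) hab.symm hf3' hbS haS hb)
    · rw [wants_flip_of_notMem hS haS] at ha
      rw [wants_flip_of_notMem hS hbS] at hb
      exact ⟨a, b, hab, ha, hb⟩
  · rintro ⟨-, a, b, hab, ha, hb⟩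
    rcases hab.eq_and_eq_or_eq_and_eq hyz with ⟨rfl, rfl⟩ | ⟨rfl, rfl⟩
    · exact hmix m a b 1 (by omega) hab h3 hyS hzS ha hb
    · exact hmix m b a 2 (by omega) hab.symm h3 hyS hzS hb ha

lemma exists_isRepairSet_forall_not_isConflict (hE : G.edgeSet.Finite) (hl : G.Loopless)
    (hm : G.IsMinThreeColoring c) (hP : G.IsRepairSet c P) :
    ∃ c', G.IsMinThreeColoring c' ∧ G.IsRepairSet c' P ∧ ∀ m, ¬ G.IsConflict c' P m := by
  obtain ⟨c', ⟨hm', hP'⟩, hmin⟩ := exists_forall_le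
    (p := fun c' => G.IsMinThreeColoring c' ∧ G.IsRepairSet c' P)
    (fun c' => {m | G.IsConflict c' P m}.ncard) ⟨c, hm, hP⟩
  refine ⟨c', hm', hP', fun m hconf => ?_⟩
  have key : ∀ S, G.KempeClosed c' S →
      (∀ f, G.IsConflict (G.flip c' S) P f → G.IsConflict c' P f) →
      ¬ G.IsConflict (G.flip c' S) P m → False := by
    intro S hS hsub hnot
    have hlt : {f | G.IsConflict (G.flip c' S) P f}.ncard < {f | G.IsConflict c' P f}.ncard := by
      refine Set.ncard_lt_ncard ⟨hsub, fun hsup => hnot (hsup hconf)⟩ (hE.subset ?_)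
      rintro f ⟨-, a, b, hab, -⟩
      exact hab.edge_mem
    have := hmin _ ⟨hm'.flip hS, hP'.congr fun e he => hm'.1.flip_eq_three_iff he⟩
    omega
  obtain ⟨h3, y, z, hyz, hy, hz⟩ := hconf
  by_cases hyT : y ∈ G.cubicSet
  · obtain ⟨S, hS, h1, h2⟩ :=
      hP'.exists_flip_of_conflict hE hl hm' (.inl rfl) hyz h3 hy hz hyT
    exact key S hS h1 h2
  by_cases hzT : z ∈ G.cubicSet
  · obtain ⟨S, hS, h1, h2⟩ :=
      hP'.exists_flip_of_conflict hE hl hm' (.inr rfl) hyz.symm h3 hz hy hzT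
    exact key S hS h1 h2
  -- With both ends non-cubic, m has a repairing edge in P at one end, and that end can want
  -- nothing.
  obtain ⟨h, hhP, u, v, w, he, -, -, hh, -⟩ := hP'.exists_mem m y z hyz h3 hyT hzT
  rcases he.left_eq_or_eq hyz with rfl | rfl
  · exact hP'.notMem_of_wants hm'.1 (.inl rfl) hy hyT hh.inc_left hhP
  · exact hP'.notMem_of_wants hm'.1 (.inr rfl) hz hzT hh.inc_left hhP

end Repair

/-! ### The interval colouring -/

section Final

variable {α β : Type*} {G : Graph α β} {c : β → ℕ} {e f h m : β} {i j : ℕ}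
  {x y z u v w : α} {P : Set β}

open Classical in
/-- The interval colouring obtained from a `3`-edge-colouring and a set of repairing edges. -/
noncomputable def shifted (G : Graph α β) (c : β → ℕ) (P : Set β) (e : β) : ℕ :=
  if c e = 3 then (if ∃ y, G.Inc e y ∧ G.Wants c P 1 y then 5 else 2)
  else if e ∈ P then (if c e = 1 then 6 else 1) else c e + 2

/-- The residue modulo 3 recovers the old colour, so properness is inherited. -/
lemma shifted_mod (hc : G.IsProperEdgeColoring 3 c) (he : e ∈ G.edgeSet) :
    G.shifted c P e % 3 = (c e + 2) % 3 := by
  have := hc.1 e he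
  rw [Set.mem_Icc] at this
  unfold shifted
  split_ifs <;> omega

lemma shifted_mem (hc : G.IsProperEdgeColoring 3 c) (he : e ∈ G.edgeSet) :
    G.shifted c P e ∈ Set.Icc 1 6 := by
  have := hc.1 e he
  rw [Set.mem_Icc] at this ⊢
  unfold shifted
  split_ifs <;> omega

lemma shifted_of_notMem (h3 : c e ≠ 3) (he : e ∉ P) : G.shifted c P e = c e + 2 := by
  simp [shifted, h3, he]

lemma shifted_of_mem_one (h1 : c e = 1) (he : e ∈ P) : G.shifted c P e = 6 := by
  simp [shifted, h1, he]

lemma shifted_of_mem_two (h2 : c e = 2) (he : e ∈ P) : G.shifted c P e = 1 := by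
  simp [shifted, h2, he]

lemma shifted_eq_or (h3 : c e = 3) : G.shifted c P e = 2 ∨ G.shifted c P e = 5 := by
  simp only [shifted, h3, if_true]
  split_ifs <;> simp

lemma shifted_of_wants_one (hx : G.Inc m x) (h3 : c m = 3) (hw : G.Wants c P 1 x) :
    G.shifted c P m = 5 := by
  rw [shifted, if_pos h3, if_pos ⟨x, hx, hw⟩]

lemma shifted_of_wants_two (hconf : ¬ G.IsConflict c P m) (hx : G.Inc m x)
    (h3 : c m = 3) (hw : G.Wants c P 2 x) : G.shifted c P m = 2 := by
  rw [shifted, if_pos h3, if_neg]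
  rintro ⟨y, ⟨z, hyz⟩, hwy⟩
  rcases hx.eq_or_eq_of_isLink hyz with rfl | rfl
  · exact hwy.2 hw.1
  · exact hconf ⟨h3, y, x, hyz, hwy, hw⟩

lemma wants_of_missing (hi : G.Missing c i x) (hf : G.Inc f x) (hfP : f ∉ P)
    (hfc : c f = 3 - i) : G.Wants c P i x :=
  ⟨fun g hg _ => hi g hg, fun hl => hl f hf hfP hfc⟩

/-- If a repairing edge meets an edge of colour `3`, then some end of the latter wants the colour of
the repairing edge. -/
lemma IsRepairSet.exists_wants (hE : G.edgeSet.Finite) (hm : G.IsMinThreeColoring c)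
    (hP : G.IsRepairSet c P) (hh : h ∈ P) (hhx : G.Inc h x) (hmx : G.Inc m x) (h3 : c m = 3) :
    ∃ y, G.Inc m y ∧ G.Wants c P (c h) y := by
  have hc := hm.1
  obtain ⟨S, hS, hhS, huniq, hend⟩ := hP.exists_kempeClosed hE hm hh
  have hxS := hhS x hhx
  obtain ⟨e, he3, hr⟩ := hP.exists_isRepair h hh
  have hh3 := hr.color_ne_three hc he3
  have hcol := hc.color_cases hhx
  by_cases hxT : x ∈ G.cubicSet
  · refine ⟨x, hmx, fun f hf hfP hfc => hfP (hc.eq_of_inc hf hhx hfc ▸ hh), fun hl => ?_⟩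
    have hx := hc.mem_cubicSet_iff.1 hxT
    have : ¬ G.Missing c (3 - c h) x := by
      rcases hcol with h1 | h1 | h1
      · rw [h1]
        exact hx.2.1
      · rw [h1]
        exact hx.1
      · exact absurd h1 hh3
    refine this fun f hf hfc => hl f hf (fun hfP => ?_) hfc
    have := huniq f hfP x hxS hf
    subst this
    omega
  · obtain ⟨u, v, w, he, hu, hv, hhl, hwT⟩ := hr
    obtain rfl : x = u := by
      rcases hhx.eq_or_eq_of_isLink hhl with rfl | rfl
      · rfl
      · exact absurd hwT hxT
    obtain rfl := hc.eq_of_inc hmx he.inc_left (h3.trans he3.symm)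
    -- Here v is the end that wants c h = i: it misses i, and its edge of colour j is outside P
    -- because h is the only edge of P meeting the chain.
    obtain ⟨i, j, hij, hju, hiv, -, hjv⟩ := hm.exists_colors hE he h3 hu hv
    have hhi : c h = i := by
      have := hju h hhx
      omega
    refine ⟨v, he.inc_right, fun f hf _ => hhi ▸ hiv f hf, fun hl => hjv fun f hf hfj => ?_⟩
    refine hl f hf (fun hfP => ?_) (by omega)
    have := huniq f hfP v (hend m x v he h3 hxS hxT).1 hf
    subst this
    omega

lemma image_eq_Icc {F : β → ℕ} {A : Set β} (a b : ℕ) (h1 : ∀ f ∈ A, a ≤ F f ∧ F f ≤ b)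
    (h2 : ∀ n, a ≤ n → n ≤ b → ∃ f ∈ A, F f = n) : ∃ a b, F '' A = Set.Icc a b := by
  refine ⟨a, b, Set.Subset.antisymm ?_ fun n hn => h2 n hn.1 hn.2⟩
  rintro _ ⟨f, hf, rfl⟩
  exact h1 f hf

lemma exists_inc_of_not_missing (hx : ¬ G.Missing c i x) : ∃ f, G.Inc f x ∧ c f = i := by
  simpa [Missing] using hx

lemma exists_image_shifted_eq_Icc (hE : G.edgeSet.Finite) (hm : G.IsMinThreeColoring c)
    (hP : G.IsRepairSet c P) (hconf : ∀ m, ¬ G.IsConflict c P m) (x : α) :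
    ∃ a b, G.shifted c P '' G.incidenceSet x = Set.Icc a b := by
  have hc := hm.1
  -- A repairing edge of value 6 needs 5 beside it, and one of value 1 needs 2.
  have hone : ∀ h m, h ∈ P → G.Inc h x → G.Inc m x → c m = 3 → c h = 1 → G.shifted c P m = 5 := by
    intro h m hh hhx hmx h3 h1
    obtain ⟨y, hy, hw⟩ := hP.exists_wants hE hm hh hhx hmx h3
    exact shifted_of_wants_one hy h3 (h1 ▸ hw)
  have htwo : ∀ h m, h ∈ P → G.Inc h x → G.Inc m x → c m = 3 → c h = 2 → G.shifted c P m = 2 := by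
    intro h m hh hhx hmx h3 h2
    obtain ⟨y, hy, hw⟩ := hP.exists_wants hE hm hh hhx hmx h3
    exact shifted_of_wants_two (hconf m) hy h3 (h2 ▸ hw)
  have hval : ∀ f g, G.Inc f x → G.Inc g x → c f = c g → G.shifted c P f = G.shifted c P g :=
    fun f g hf hg hfg => by rw [hc.eq_of_inc hf hg hfg]
  by_cases hx3 : G.Missing c 3 x
  · have hnP : ∀ f, G.Inc f x → G.shifted c P f = c f + 2 := by
      intro f hf
      refine shifted_of_notMem (hx3 f hf) fun hfP => ?_
      obtain ⟨e, h3, u, v, w, he, hu, hv, hh, hw⟩ := hP.exists_isRepair f hfP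
      rcases hf.eq_or_eq_of_isLink hh with rfl | rfl
      · exact hx3 e he.inc_left h3
      · exact (hc.mem_cubicSet_iff.1 hw).2.2 hx3
    have hcol : ∀ f, G.Inc f x → c f = 1 ∨ c f = 2 := fun f hf => by
      have := hc.color_cases hf
      have := hx3 f hf
      omega
    by_cases hx1 : G.Missing c 1 x <;> by_cases hx2 : G.Missing c 2 x
    -- No edge at x: the bounds 1 and 0 give the empty interval.
    · refine image_eq_Icc 1 0 (fun f hf => ?_) (by omega)
      have := hcol f hf
      have := hx1 f hf
      have := hx2 f hf
      omega
    · obtain ⟨f₂, hf₂, hc₂⟩ := exists_inc_of_not_missing hx2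
      refine image_eq_Icc 4 4 (fun f hf => ?_) fun n h1 h2 => ⟨f₂, hf₂, ?_⟩
      · have := hcol f hf
        have := hx1 f hf
        have := hnP f hf
        omega
      · have := hnP f₂ hf₂
        omega
    · obtain ⟨f₁, hf₁, hc₁⟩ := exists_inc_of_not_missing hx1
      refine image_eq_Icc 3 3 (fun f hf => ?_) fun n h1 h2 => ⟨f₁, hf₁, ?_⟩
      · have := hcol f hf
        have := hx2 f hf
        have := hnP f hf
        omega
      · have := hnP f₁ hf₁
        omega
    · obtain ⟨f₁, hf₁, hc₁⟩ := exists_inc_of_not_missing hx1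
      obtain ⟨f₂, hf₂, hc₂⟩ := exists_inc_of_not_missing hx2
      have hv₁ := hnP f₁ hf₁
      have hv₂ := hnP f₂ hf₂
      refine image_eq_Icc 3 4 (fun f hf => ?_) fun n h1 h2 => ?_
      · have := hcol f hf
        have := hnP f hf
        omega
      · obtain rfl | rfl : n = 3 ∨ n = 4 := by omega
        · exact ⟨f₁, hf₁, by omega⟩
        · exact ⟨f₂, hf₂, by omega⟩
  obtain ⟨m, hmx, h3⟩ := exists_inc_of_not_missing hx3
  by_cases hx1 : G.Missing c 1 x <;> by_cases hx2 : G.Missing c 2 x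
  · refine image_eq_Icc (G.shifted c P m) (G.shifted c P m) (fun f hf => ?_)
      fun n h1 h2 => ⟨m, hmx, by omega⟩
    have := hc.color_cases hf
    have := hx1 f hf
    have := hx2 f hf
    have := hval f m hf hmx (by omega)
    omega
  · obtain ⟨f₂, hf₂, hc₂⟩ := exists_inc_of_not_missing hx2
    have hall : ∀ f, G.Inc f x → G.shifted c P f = G.shifted c P m ∨
        G.shifted c P f = G.shifted c P f₂ := by
      intro f hf
      have := hx1 f hf
      rcases hc.color_cases hf with h | h | h
      · omega
      · exact .inr (hval f f₂ hf hf₂ (by omega))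
      · exact .inl (hval f m hf hmx (by omega))
    by_cases hfP : f₂ ∈ P
    · have hv₂ := shifted_of_mem_two (G := G) hc₂ hfP
      have hvm := htwo f₂ m hfP hf₂ hmx h3 hc₂
      refine image_eq_Icc 1 2 (fun f hf => by have := hall f hf; omega) fun n h1 h2 => ?_
      obtain rfl | rfl : n = 1 ∨ n = 2 := by omega
      · exact ⟨f₂, hf₂, hv₂⟩
      · exact ⟨m, hmx, hvm⟩
    · have hv₂ := shifted_of_notMem (G := G) (c := c) (e := f₂) (by omega) hfP
      have hvm := shifted_of_wants_one hmx h3 (wants_of_missing hx1 hf₂ hfP (by omega))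
      refine image_eq_Icc 4 5 (fun f hf => by have := hall f hf; omega) fun n h1 h2 => ?_
      obtain rfl | rfl : n = 4 ∨ n = 5 := by omega
      · exact ⟨f₂, hf₂, by omega⟩
      · exact ⟨m, hmx, hvm⟩
  · obtain ⟨f₁, hf₁, hc₁⟩ := exists_inc_of_not_missing hx1
    have hall : ∀ f, G.Inc f x → G.shifted c P f = G.shifted c P m ∨
        G.shifted c P f = G.shifted c P f₁ := by
      intro f hf
      have := hx2 f hf
      rcases hc.color_cases hf with h | h | h
      · exact .inr (hval f f₁ hf hf₁ (by omega))
      · omega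
      · exact .inl (hval f m hf hmx (by omega))
    by_cases hfP : f₁ ∈ P
    · have hv₁ := shifted_of_mem_one (G := G) hc₁ hfP
      have hvm := hone f₁ m hfP hf₁ hmx h3 hc₁
      refine image_eq_Icc 5 6 (fun f hf => by have := hall f hf; omega) fun n h1 h2 => ?_
      obtain rfl | rfl : n = 5 ∨ n = 6 := by omega
      · exact ⟨m, hmx, hvm⟩
      · exact ⟨f₁, hf₁, hv₁⟩
    · have hv₁ := shifted_of_notMem (G := G) (c := c) (e := f₁) (by omega) hfP
      have hvm := shifted_of_wants_two (hconf m) hmx h3 (wants_of_missing hx2 hf₁ hfP (by omega))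
      refine image_eq_Icc 2 3 (fun f hf => by have := hall f hf; omega) fun n h1 h2 => ?_
      obtain rfl | rfl : n = 2 ∨ n = 3 := by omega
      · exact ⟨m, hmx, hvm⟩
      · exact ⟨f₁, hf₁, by omega⟩
  · obtain ⟨f₁, hf₁, hc₁⟩ := exists_inc_of_not_missing hx1
    obtain ⟨f₂, hf₂, hc₂⟩ := exists_inc_of_not_missing hx2
    have hall : ∀ f, G.Inc f x → G.shifted c P f = G.shifted c P m ∨
        G.shifted c P f = G.shifted c P f₁ ∨ G.shifted c P f = G.shifted c P f₂ := by
      intro f hf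
      rcases hc.color_cases hf with h | h | h
      · exact .inr (.inl (hval f f₁ hf hf₁ (by omega)))
      · exact .inr (.inr (hval f f₂ hf hf₂ (by omega)))
      · exact .inl (hval f m hf hmx (by omega))
    have huniq : f₁ ∈ P → f₂ ∉ P := by
      intro h₁ h₂
      obtain ⟨S, -, hS, hu, -⟩ := hP.exists_kempeClosed hE hm h₁
      have := hu f₂ h₂ x (hS x hf₁) hf₂
      subst this
      omega
    have hex : ∀ a, (∀ n, a ≤ n → n ≤ a + 2 → n = G.shifted c P m ∨ n = G.shifted c P f₁ ∨
        n = G.shifted c P f₂) → ∀ n, a ≤ n → n ≤ a + 2 →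
        ∃ f ∈ G.incidenceSet x, G.shifted c P f = n := by
      intro a ha n h1 h2
      rcases ha n h1 h2 with rfl | rfl | rfl
      · exact ⟨m, hmx, rfl⟩
      · exact ⟨f₁, hf₁, rfl⟩
      · exact ⟨f₂, hf₂, rfl⟩
    have hgoal : ∀ a, (∀ n, a ≤ n → n ≤ a + 2 → n = G.shifted c P m ∨ n = G.shifted c P f₁ ∨
        n = G.shifted c P f₂) → (a ≤ G.shifted c P m ∧ G.shifted c P m ≤ a + 2) →
        (a ≤ G.shifted c P f₁ ∧ G.shifted c P f₁ ≤ a + 2) →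
        (a ≤ G.shifted c P f₂ ∧ G.shifted c P f₂ ≤ a + 2) →
        ∃ a b, G.shifted c P '' G.incidenceSet x = Set.Icc a b := fun a h0 h1 h2 h3 =>
      image_eq_Icc a (a + 2) (fun f hf => by have := hall f hf; omega) (hex a h0)
    by_cases hP₁ : f₁ ∈ P
    · have hv₁ := shifted_of_mem_one (G := G) hc₁ hP₁
      have hvm := hone f₁ m hP₁ hf₁ hmx h3 hc₁
      have hv₂ := shifted_of_notMem (G := G) (c := c) (e := f₂) (by omega) (huniq hP₁)
      exact hgoal 4 (by omega) (by omega) (by omega) (by omega)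
    have hv₁ := shifted_of_notMem (G := G) (c := c) (e := f₁) (by omega) hP₁
    by_cases hP₂ : f₂ ∈ P
    · have hv₂ := shifted_of_mem_two (G := G) hc₂ hP₂
      have hvm := htwo f₂ m hP₂ hf₂ hmx h3 hc₂
      exact hgoal 1 (by omega) (by omega) (by omega) (by omega)
    have hv₂ := shifted_of_notMem (G := G) (c := c) (e := f₂) (by omega) hP₂
    -- With 3 and 4 present, either value of m completes an interval.
    rcases shifted_eq_or (G := G) (P := P) h3 with hvm | hvm
    · exact hgoal 2 (by omega) (by omega) (by omega) (by omega)
    · exact hgoal 3 (by omega) (by omega) (by omega) (by omega)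

end Final

end Graph

theorem mainTheorem1 {α β : Type*} (G : Graph α β) (hV : G.vertexSet.Finite)
    (hE : G.edgeSet.Finite) (hloop : G.Loopless)
    (hchi : G.chromaticIndex = G.maxDegree) (hdeg : G.maxDegree ≤ 3)
    (hodd : ∀ H : Graph α β, H.IsComponent G → ¬ H.IsOddCycle) :
    G.IntervalColorable := by
  obtain ⟨c₀, hc₀⟩ := G.exists_isProperEdgeColoring_chromaticIndex hE
  have hc₃ : G.IsProperEdgeColoring 3 c₀ :=
    ⟨fun e he => Set.Icc_subset_Icc_right (hchi.trans_le hdeg) (hc₀.1 e he), hc₀.2⟩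
  obtain ⟨c₁, hm₁, hex⟩ :=
    Graph.exists_isMinThreeColoring_isRepair hV hE hloop hodd ⟨c₀, hc₃⟩
  obtain ⟨P, hP₁⟩ := Graph.exists_isRepairSet hm₁.1 hex
  obtain ⟨c, hm, hP, hconf⟩ :=
    Graph.exists_isRepairSet_forall_not_isConflict hE hloop hm₁ hP₁
  refine ⟨6, G.shifted c P, ⟨fun e he => Graph.shifted_mem hm.1 he, ?_⟩,
    fun v _ => Graph.exists_image_shifted_eq_Icc hE hm hP hconf v⟩
  intro e f x he hf hne h
  have h1 := Graph.shifted_mod (P := P) hm.1 he.edge_mem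
  have h2 := Graph.shifted_mod (P := P) hm.1 hf.edge_mem
  have h3 := hm.1.color_cases he
  have h4 := hm.1.color_cases hf
  exact hm.1.2 e f x he hf hne (by omega)
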